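/- Let $\mathbb{K}$ be a field of characteristic zero. A packed matrix is a matrix with coefficients in $\mathbb{N}$ with no zero row and no zero column; the empty matrix, with $0$ rows and $0$ columns and denoted by $1$, is packed. Let $\mathrm{Pack}$ be the set of packed matrices and $\mathbf{H}_{\mathrm{Pack}}$ the $\mathbb{K}$-vector space with basis $\mathrm{Pack}$. For packed matrices $M,M'$ put $M\searrow M'=\begin{pmatrix}M&0\\0&M'\end{pmatrix}$. For a map $\alpha:[k]\to[l]$, where $[k]=\{1,\ldots,k\}$, let $\mu(\alpha)$ be the $l\times k$ matrix with coefficients $\mu(\alpha)_{i,j}=\delta_{i,\alpha(j)}$. Let $\mathrm{qsh}(k,l)$ be the set of surjective maps $\sigma:[k+l]\to[n]$, for any $n$, with $\sigma(1)<\cdots<\sigma(k)$ and $\sigma(k+1)<\cdots<\sigma(k+l)$. Let $\mathrm{Adm}(k)$ be the set of pairs of surjective maps $\sigma':[k]\to[k']$, $\sigma'':[k]\to[k'']$, for any $k',k''$, such that $\sigma'$ is weakly increasing and $\sigma''(i)<\sigma''(j)$ whenever $i<j$ and $\sigma'(i)=\sigma'(j)$. For $M,M'\in\mathrm{Pack}$,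 with respectively $k,k'$ rows and $l,l'$ columns, put \[M\sqcup\!\sqcup M'=\sum_{\sigma\in\mathrm{qsh}(k,k'),\ \tau\in\mathrm{qsh}(l,l')}\mu(\sigma)(M\searrow M')\mu(\tau)^\top,\qquad \Delta(M)=\sum_{\substack{M_1,M_2\in\mathrm{Pack}\\ M=M_1\searrow M_2}}M_1\otimes M_2,\] \[\delta(M)=\sum_{\substack{(\sigma',\sigma'')\in\mathrm{Adm}(k)\\(\tau',\tau'')\in\mathrm{Adm}(l)}}\mu(\sigma')M\mu(\tau')^\top\otimes\mu(\sigma'')M\mu(\tau'')^\top,\] and extend these linearly. The unit of $\sqcup\!\sqcup$ is the empty matrix; the counit of $\Delta$ is $1$ on the empty matrix and $0$ on every other packed matrix; the counit of $\delta$ is $1$ on the empty matrix and on the packed matrices with one row and one column, and $0$ on every other packed matrix. The polynomial algebra $(\mathbb{K}[X],m)$ is given the two multiplicative coproducts $\Delta(X)=X\otimes1+1\otimes X$ and $\delta(X)=X\otimes X$, whose counits are the evaluations at $0$ and at $1$. A (commutative) double bialgebra is a family $(A,m,\Delta,\delta)$ such that $(A,m,\delta)$ is a commutative bialgebra and $(A,m,\Delta)$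 is a commutative bialgebra in the category of right comodules over $(A,m,\delta)$, with coaction $\delta$. A double bialgebra morphism is a linear map which is a bialgebra morphism both for $(m,\Delta)$ and for $(m,\delta)$ (units and counits included). Then $(\mathbf{H}_{\mathrm{Pack}},\sqcup\!\sqcup,\Delta,\delta)$ and $(\mathbb{K}[X],m,\Delta,\delta)$ are double bialgebras, and there is a unique double bialgebra morphism $\phi$ from the first to the second. It is given, for every packed matrix $M$ with $\mathrm{row}(M)$ rows, by \[\phi(M)=\begin{cases}H_{\mathrm{row}(M)}(X)&\text{if }M\text{ is diagonal (that is, square with zero off-diagonal coefficients)},\\0&\text{otherwise,}\end{cases}\] where $H_n(X)=\dfrac{X(X-1)\cdots(X-n+1)}{n!}$ is the $n$-th Hilbert polynomial ($H_0=1$, and the empty matrix is diagonal). -/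

import Mathlib

open scoped TensorProduct Polynomial Matrix

/-! ## Double bialgebras -/

/-- The operations of a double bialgebra on a `K`-module `A`: a product, a unit, and two coproducts
`Δ` (`comul`) and `δ` (`delta`) with their counits. The axioms are in `IsDoubleBialgebra`. -/
structure DoubleBialgebraOps (K A : Type*) [Field K] [AddCommGroup A] [Module K A] where
  mul : A ⊗[K] A →ₗ[K] A
  one : A
  comul : A →ₗ[K] A ⊗[K] A
  counit : A →ₗ[K] K
  delta : A →ₗ[K] A ⊗[K] A
  deltaCounit : A →ₗ[K] K

/-- `(A, m, 1, Δ, ε)` is a commutative bialgebra over `K`: `(A, m, 1)` is an associative commutative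
unitary algebra, `(A, Δ, ε)` is a coassociative counitary coalgebra, and `Δ` and `ε` are morphisms of
unitary algebras. -/
structure IsCommBialgebra {K A : Type*} [Field K] [AddCommGroup A] [Module K A]
    (m : A ⊗[K] A →ₗ[K] A) (one : A) (Δ : A →ₗ[K] A ⊗[K] A) (ε : A →ₗ[K] K) : Prop where
  mul_assoc : ∀ a b c : A, m (m (a ⊗ₜ b) ⊗ₜ c) = m (a ⊗ₜ m (b ⊗ₜ c))
  mul_comm : ∀ a b : A, m (a ⊗ₜ b) = m (b ⊗ₜ a)
  one_mul : ∀ a : A, m (one ⊗ₜ a) = a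
  coassoc : ∀ a : A, TensorProduct.assoc K A A A (Δ.rTensor A (Δ a)) = Δ.lTensor A (Δ a)
  counit_left : ∀ a : A, ε.rTensor A (Δ a) = (1 : K) ⊗ₜ[K] a
  counit_right : ∀ a : A, ε.lTensor A (Δ a) = a ⊗ₜ[K] (1 : K)
  comul_one : Δ one = one ⊗ₜ one
  comul_mul : ∀ a b : A, Δ (m (a ⊗ₜ b)) =
    TensorProduct.map m m (TensorProduct.tensorTensorTensorComm K A A A A (Δ a ⊗ₜ Δ b))
  counit_one : ε one = 1
  counit_mul : ∀ a b : A, ε (m (a ⊗ₜ b)) = ε a * ε b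

/-- `(A, m, Δ, δ)` is a (commutative) double bialgebra: `(A, m, δ)` is a commutative bialgebra and
`(A, m, Δ)` is a commutative bialgebra in the category of right comodules over `(A, m, δ)`, with the
coaction `δ`. That `m` and the unit are comodule morphisms means that `δ` is a morphism of unitary
algebras; that `Δ` and its counit are comodule morphisms is `comul_delta` and `counit_delta`. -/
structure IsDoubleBialgebra {K A : Type*} [Field K] [AddCommGroup A] [Module K A]
    (D : DoubleBialgebraOps K A) : Prop where
  bialgebra_comul : IsCommBialgebra D.mul D.one D.comul D.counit
  bialgebra_delta : IsCommBialgebra D.mul D.one D.delta D.deltaCounit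
  /-- `(Δ ⊗ Id) ∘ δ = (Id ⊗ Id ⊗ m) ∘ (Id ⊗ c ⊗ Id) ∘ (δ ⊗ δ) ∘ Δ`. -/
  comul_delta : ∀ a : A, D.comul.rTensor A (D.delta a) =
    D.mul.lTensor (A ⊗[K] A) (TensorProduct.tensorTensorTensorComm K A A A A
      (TensorProduct.map D.delta D.delta (D.comul a)))
  /-- `(ε_Δ ⊗ Id) ∘ δ (a) = ε_Δ(a) 1`. -/
  counit_delta : ∀ a : A, D.counit.rTensor A (D.delta a) = D.counit a ⊗ₜ[K] D.one

/-- Morphisms of double bialgebras: linear maps which are bialgebra morphisms both for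
`(m, Δ)` and for `(m, δ)`. -/
structure IsDoubleBialgebraHom {K A B : Type*} [Field K] [AddCommGroup A] [Module K A]
    [AddCommGroup B] [Module K B] (D : DoubleBialgebraOps K A) (E : DoubleBialgebraOps K B)
    (φ : A →ₗ[K] B) : Prop where
  map_one : φ D.one = E.one
  map_mul : ∀ a b : A, φ (D.mul (a ⊗ₜ b)) = E.mul (φ a ⊗ₜ φ b)
  map_comul : ∀ a : A, E.comul (φ a) = TensorProduct.map φ φ (D.comul a)
  map_counit : ∀ a : A, E.counit (φ a) = D.counit a
  map_delta : ∀ a : A, E.delta (φ a) = TensorProduct.map φ φ (D.delta a)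
  map_deltaCounit : ∀ a : A, E.deltaCounit (φ a) = D.deltaCounit a

/-! ## The double bialgebra of polynomials -/

/-- `K[X]` with its usual product and the two multiplicative coproducts given by
`Δ(X) = X ⊗ 1 + 1 ⊗ X` and `δ(X) = X ⊗ X`; the counits are the evaluations at `0` and at `1`. -/
noncomputable def polyOps (K : Type*) [Field K] : DoubleBialgebraOps K K[X] where
  mul := LinearMap.mul' K K[X]
  one := 1
  comul := (Polynomial.aeval
    ((Polynomial.X : K[X]) ⊗ₜ[K] (1 : K[X]) + (1 : K[X]) ⊗ₜ[K] (Polynomial.X : K[X]))).toLinearMap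
  counit := (Polynomial.aeval (0 : K)).toLinearMap
  delta := (Polynomial.aeval ((Polynomial.X : K[X]) ⊗ₜ[K] (Polynomial.X : K[X]))).toLinearMap
  deltaCounit := (Polynomial.aeval (1 : K)).toLinearMap

/-- The Hilbert polynomial `H_n(X) = X (X - 1) ⋯ (X - n + 1) / n!`. -/
noncomputable def hilbertPoly (K : Type*) [Field K] (n : ℕ) : K[X] :=
  Polynomial.C ((n.factorial : K)⁻¹) *
    ∏ i ∈ Finset.range n, (Polynomial.X - Polynomial.C (i : K))

/-! ## Packed matrices -/

/-- A packed matrix: a matrix with natural coefficients with no zero row and no zero column. The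
conditions force `row = 0 ↔ col = 0`, so the only degenerate one is the empty `0 × 0` matrix. -/
@[ext]
structure PackedMatrix where
  row : ℕ
  col : ℕ
  mat : Matrix (Fin row) (Fin col) ℕ
  row_ne_zero : ∀ i, ∃ j, mat i j ≠ 0
  col_ne_zero : ∀ j, ∃ i, mat i j ≠ 0

namespace PackedMatrix

/-- The empty matrix. -/
def empty : PackedMatrix where
  row := 0
  col := 0
  mat := 0
  row_ne_zero i := i.elim0
  col_ne_zero j := j.elim0

/-- A matrix is diagonal if it is square and its off-diagonal coefficients vanish. -/
def IsDiagonal (M : PackedMatrix) : Prop :=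
  M.row = M.col ∧ ∀ (i : Fin M.row) (j : Fin M.col), (i : ℕ) ≠ (j : ℕ) → M.mat i j = 0

/-- The block matrix `M ↘ N` with diagonal blocks `M` and `N`. -/
def block (M N : PackedMatrix) : PackedMatrix where
  row := M.row + N.row
  col := M.col + N.col
  mat := Matrix.reindex finSumFinEquiv finSumFinEquiv (Matrix.fromBlocks M.mat 0 0 N.mat)
  row_ne_zero i := by
    obtain ⟨i, rfl⟩ := finSumFinEquiv.surjective i
    rcases i with i | i
    · obtain ⟨j, hj⟩ := M.row_ne_zero i
      exact ⟨finSumFinEquiv (Sum.inl j), by simpa using hj⟩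
    · obtain ⟨j, hj⟩ := N.row_ne_zero i
      exact ⟨finSumFinEquiv (Sum.inr j), by simpa using hj⟩
  col_ne_zero j := by
    obtain ⟨j, rfl⟩ := finSumFinEquiv.surjective j
    rcases j with j | j
    · obtain ⟨i, hi⟩ := M.col_ne_zero j
      exact ⟨finSumFinEquiv (Sum.inl i), by simpa using hi⟩
    · obtain ⟨i, hi⟩ := N.col_ne_zero j
      exact ⟨finSumFinEquiv (Sum.inr i), by simpa using hi⟩

/-- The matrix `μ(α)` of a map `α`, with coefficients `μ(α) i j = δ_{i, α j}`. -/
def mu {k l : ℕ} (α : Fin k → Fin l) : Matrix (Fin l) (Fin k) ℕ :=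
  Matrix.of fun i j => if i = α j then 1 else 0

theorem mu_mul_mul_apply {k l n m : ℕ} (σ : Fin k → Fin n) (τ : Fin l → Fin m)
    (A : Matrix (Fin k) (Fin l) ℕ) (i : Fin n) (j : Fin m) :
    (mu σ * A * (mu τ)ᵀ) i j =
      ∑ b, ∑ a, if i = σ a ∧ j = τ b then A a b else 0 := by
  simp only [Matrix.mul_apply, mu, Matrix.of_apply, Matrix.transpose_apply, Finset.sum_mul]
  refine Finset.sum_congr rfl fun b _ => Finset.sum_congr rfl fun a _ => ?_
  by_cases h1 : i = σ a <;> by_cases h2 : j = τ b <;> simp [h1, h2]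

theorem mu_mul_mul_ne_zero {k l n m : ℕ} (σ : Fin k → Fin n) (τ : Fin l → Fin m)
    (A : Matrix (Fin k) (Fin l) ℕ) {a : Fin k} {b : Fin l} (h : A a b ≠ 0) :
    (mu σ * A * (mu τ)ᵀ) (σ a) (τ b) ≠ 0 := by
  rw [mu_mul_mul_apply]
  intro h0
  rw [Finset.sum_eq_zero_iff] at h0
  have h1 := h0 b (Finset.mem_univ b)
  rw [Finset.sum_eq_zero_iff] at h1
  have h2 := h1 a (Finset.mem_univ a)
  simp only [and_self, if_true] at h2
  exact h h2

/-- The packed matrix `μ(σ) M μ(τ)ᵀ`, for surjective maps `σ` and `τ`. -/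
def push (M : PackedMatrix) {n m : ℕ} (σ : Fin M.row → Fin n) (τ : Fin M.col → Fin m)
    (hσ : Function.Surjective σ) (hτ : Function.Surjective τ) : PackedMatrix where
  row := n
  col := m
  mat := mu σ * M.mat * (mu τ)ᵀ
  row_ne_zero i := by
    obtain ⟨a, rfl⟩ := hσ i
    obtain ⟨b, hb⟩ := M.row_ne_zero a
    exact ⟨τ b, mu_mul_mul_ne_zero σ τ M.mat hb⟩
  col_ne_zero j := by
    obtain ⟨b, rfl⟩ := hτ j
    obtain ⟨a, ha⟩ := M.col_ne_zero b
    exact ⟨σ a, mu_mul_mul_ne_zero σ τ M.mat ha⟩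

/-- A packed matrix has finitely many factorisations `M = M' ↘ M''`. -/
theorem finite_block_eq (M : PackedMatrix) :
    {p : PackedMatrix × PackedMatrix | M = p.1.block p.2}.Finite := by
  refine Set.Finite.of_injOn (f := fun p => (p.1.row, p.1.col))
    (t := (Set.Iic M.row) ×ˢ (Set.Iic M.col)) ?_ ?_ ((Set.finite_Iic _).prod (Set.finite_Iic _))
  · rintro ⟨P, Q⟩ h
    simp only [Set.mem_ofPred_eq] at h
    subst h
    simp [block]
  · rintro ⟨⟨a, b, P, h1, h2⟩, ⟨c, d, Q, h3, h4⟩⟩ h ⟨⟨a', b', P', h1', h2'⟩, ⟨c', d', Q', h3', h4'⟩⟩ h' e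
    simp only [Prod.mk.injEq, Set.mem_ofPred_eq] at e h h'
    obtain ⟨rfl, rfl⟩ := e
    have hh := h.symm.trans h'
    have hr := congrArg PackedMatrix.row hh
    have hc := congrArg PackedMatrix.col hh
    simp only [block, Nat.add_left_cancel_iff] at hr hc
    subst hr hc
    simp only [block, PackedMatrix.mk.injEq, heq_eq_eq, true_and, EmbeddingLike.apply_eq_iff_eq,
      Matrix.fromBlocks_inj] at hh
    obtain ⟨rfl, -, -, rfl⟩ := hh
    rfl

end PackedMatrix

/-- `(k, l)`-quasi-shuffles: surjective maps `σ : [k + l] → [n]` with `σ(1) < ⋯ < σ(k)` and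
`σ(k + 1) < ⋯ < σ(k + l)`, for all `n` (surjectivity forces `n ≤ k + l`). -/
abbrev QuasiShuffle (k l : ℕ) : Type :=
  Σ n : Fin (k + l + 1), {σ : Fin (k + l) → Fin n // Function.Surjective σ ∧
    StrictMono (fun i : Fin k => σ (Fin.castAdd l i)) ∧
    StrictMono (fun j : Fin l => σ (Fin.natAdd k j))}

/-- `Adm(k)`: pairs of surjective maps `σ' : [k] → [k']` and `σ'' : [k] → [k'']` (so `k', k'' ≤ k`),
with `σ'` weakly increasing, such that `σ''(i) < σ''(j)` whenever `i < j` and `σ'(i) = σ'(j)`. -/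
abbrev Adm (k : ℕ) : Type :=
  Σ n : Fin (k + 1) × Fin (k + 1), {σ : (Fin k → Fin n.1) × (Fin k → Fin n.2) //
    Function.Surjective σ.1 ∧ Function.Surjective σ.2 ∧ Monotone σ.1 ∧
    ∀ i j, i < j → σ.1 i = σ.1 j → σ.2 i < σ.2 j}

/-! ## The double bialgebra of packed matrices -/

/-- The `K`-vector space with basis the set of packed matrices. -/
abbrev HPack (K : Type*) [Field K] : Type _ := PackedMatrix →₀ K

namespace HPack

variable (K : Type*) [Field K]

/-- A packed matrix as an element of the basis of `HPack K`. -/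
noncomputable def basis (M : PackedMatrix) : HPack K := Finsupp.single M 1

open scoped Classical in
/-- The quasi-shuffle product of two packed matrices: the sum of the `μ(σ) (M ↘ N) μ(τ)ᵀ`
over all quasi-shuffles `σ` of the rows and `τ` of the columns. -/
noncomputable def quasiShuffle (M N : PackedMatrix) : HPack K :=
  ∑ σ : QuasiShuffle M.row N.row, ∑ τ : QuasiShuffle M.col N.col,
    basis K ((M.block N).push σ.2.1 τ.2.1 σ.2.2.1 τ.2.2.1)

/-- The coproduct `Δ(M)`: the sum of the `M' ⊗ M''` over all factorisations `M = M' ↘ M''`. -/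
noncomputable def deconcatenation (M : PackedMatrix) : HPack K ⊗[K] HPack K :=
  ∑ p ∈ M.finite_block_eq.toFinset, basis K p.1 ⊗ₜ[K] basis K p.2

open scoped Classical in
/-- The coproduct `δ(M)`: the sum of the `μ(σ') M μ(τ')ᵀ ⊗ μ(σ'') M μ(τ'')ᵀ` over all
`(σ', σ'')` in `Adm(row M)` and `(τ', τ'')` in `Adm(col M)`. -/
noncomputable def internalCoproduct (M : PackedMatrix) : HPack K ⊗[K] HPack K :=
  ∑ σ : Adm M.row, ∑ τ : Adm M.col,
    basis K (M.push σ.2.1.1 τ.2.1.1 σ.2.2.1 τ.2.2.1) ⊗ₜ[K]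
      basis K (M.push σ.2.1.2 τ.2.1.2 σ.2.2.2.1 τ.2.2.2.1)

open scoped Classical in
/-- The operations of `HPack K`, extended linearly from the basis of packed matrices. The counit of
`Δ` is `1` on the empty matrix and `0` on the other packed matrices; the counit of `δ` is `1` on the
empty matrix and on the packed matrices with one row and one column, and `0` on the others. -/
noncomputable def ops : DoubleBialgebraOps K (HPack K) where
  mul := TensorProduct.lift (Finsupp.lift (HPack K →ₗ[K] HPack K) K PackedMatrix
    fun M => Finsupp.lift (HPack K) K PackedMatrix fun N => quasiShuffle K M N)
  one := basis K PackedMatrix.empty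
  comul := Finsupp.lift (HPack K ⊗[K] HPack K) K PackedMatrix (deconcatenation K)
  counit := Finsupp.lift K K PackedMatrix fun M => if M = PackedMatrix.empty then 1 else 0
  delta := Finsupp.lift (HPack K ⊗[K] HPack K) K PackedMatrix (internalCoproduct K)
  deltaCounit := Finsupp.lift K K PackedMatrix fun M =>
    if M = PackedMatrix.empty ∨ (M.row = 1 ∧ M.col = 1) then 1 else 0

end HPack

/-! A packed matrix `M` is read as a quasi-symmetric series in a matrix of variables: its value at a
matrix `a` with ordered rows and columns sums, over strictly increasing placements of the rows and
columns of `M` in those of `a`, the monomial in the entries of `a` with exponents `M` (`evalAt`).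
This value is multiplicative for the quasi-shuffle product. The coproduct `Δ` corresponds to the
block sum of the matrices `a` and `b` (`sum_evalAt_block`), and `δ` to their Kronecker product with
lexicographically ordered indices (`sum_evalAt_adm`); the two counits are the values at the identity
matrices of sizes 0 and 1.

These characters separate points, because the value of `M` at a generic matrix of the size of `N`
contains the monomial with exponents `N` exactly when `M = N`, and a nonzero polynomial over an
infinite field has a nonzero value. Every axiom may therefore be tested on characters, where it
becomes a law for sums and products of ordered matrices (`IsDoubleBialgebra.of_separating`). For
`K[X]` the same argument uses the evaluations at natural numbers.

The identity matrices form a copy of the semiring ℕ inside the matrices. The value of `M` at the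
identity of size `n` is `n.choose M.row` if `M` is diagonal and 0 otherwise, that is, the value at
`n` of the stated polynomial. So the map intertwines evaluation at `n` with the character of the
identity of size `n`, which makes it a morphism. For any other morphism the counits fix the
evaluations at 0 and 1, and `Δ` then fixes those at all `n`. -/

/-! ## Double bialgebras from families of characters -/

section TensorForm

variable {K : Type*} [Field K]

/-- The linear form on `V ⊗ W` induced by linear forms on `V` and `W`. -/
noncomputable def tensorForm {V W : Type*} [AddCommGroup V] [Module K V] [AddCommGroup W]
    [Module K W] (f : V →ₗ[K] K) (g : W →ₗ[K] K) : V ⊗[K] W →ₗ[K] K :=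
  LinearMap.mul' K K ∘ₗ TensorProduct.map f g

/-- A family of linear forms is separating if only `0` is killed by all of them. -/
def Separating {V ι : Type*} [AddCommGroup V] [Module K V] (χ : ι → V →ₗ[K] K) : Prop :=
  ∀ x, (∀ i, χ i x = 0) → x = 0

section

variable {V W ι κ : Type*} [AddCommGroup V] [Module K V] [AddCommGroup W] [Module K W]

@[simp]
theorem tensorForm_tmul (f : V →ₗ[K] K) (g : W →ₗ[K] K) (v : V) (w : W) :
    tensorForm f g (v ⊗ₜ w) = f v * g w := by
  simp [tensorForm]

theorem tensorForm_rTensor {V' : Type*} [AddCommGroup V'] [Module K V'] (f : V' →ₗ[K] K)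
    (g : W →ₗ[K] K) (u : V →ₗ[K] V') (x : V ⊗[K] W) :
    tensorForm f g (u.rTensor W x) = tensorForm (f ∘ₗ u) g x := by
  induction x with
  | zero => simp
  | tmul v w => simp
  | add x y hx hy => simp only [map_add, hx, hy]

theorem tensorForm_lTensor {W' : Type*} [AddCommGroup W'] [Module K W'] (f : V →ₗ[K] K)
    (g : W' →ₗ[K] K) (u : W →ₗ[K] W') (x : V ⊗[K] W) :
    tensorForm f g (u.lTensor V x) = tensorForm f (g ∘ₗ u) x := by
  induction x with
  | zero => simp
  | tmul v w => simp
  | add x y hx hy => simp only [map_add, hx, hy]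

theorem tensorForm_map {V' W' : Type*} [AddCommGroup V'] [Module K V'] [AddCommGroup W']
    [Module K W'] (f : V' →ₗ[K] K) (g : W' →ₗ[K] K) (u : V →ₗ[K] V') (u' : W →ₗ[K] W')
    (x : V ⊗[K] W) :
    tensorForm f g (TensorProduct.map u u' x) = tensorForm (f ∘ₗ u) (g ∘ₗ u') x := by
  induction x with
  | zero => simp
  | tmul v w => simp
  | add x y hx hy => simp only [map_add, hx, hy]

theorem tensorForm_assoc {U : Type*} [AddCommGroup U] [Module K U] (f : U →ₗ[K] K)
    (g : V →ₗ[K] K) (h : W →ₗ[K] K) (x : (U ⊗[K] V) ⊗[K] W) :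
    tensorForm f (tensorForm g h) (TensorProduct.assoc K U V W x) =
      tensorForm (tensorForm f g) h x := by
  have : tensorForm f (tensorForm g h) ∘ₗ (TensorProduct.assoc K U V W).toLinearMap =
      tensorForm (tensorForm f g) h := by
    ext
    simp [mul_assoc]
  exact LinearMap.congr_fun this x

namespace Separating

variable {χ : ι → V →ₗ[K] K} {θ : κ → W →ₗ[K] K}

theorem eq (hχ : Separating χ) {x y : V} (h : ∀ i, χ i x = χ i y) : x = y :=
  sub_eq_zero.1 <| hχ _ fun i => by rw [map_sub, h, sub_self]

/-- Contracting the left factor with `χ i` gives a vector of `W` killed by every `θ j`, hence zero.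
Its coordinates in a basis of `W` are the values of `χ i` on the `V`-valued coordinates of `x`, so
these vanish too. -/
theorem tensor (hχ : Separating χ) (hθ : Separating θ) :
    Separating (fun p : ι × κ => tensorForm (χ p.1) (θ p.2)) := by
  classical
  intro x hx
  let b := Module.Basis.ofVectorSpace K W
  let e := TensorProduct.equivFinsuppOfBasisRight (M := V) b
  have key : ∀ (f : V →ₗ[K] K) (y : V ⊗[K] W) (k : _),
      b.repr (TensorProduct.lid K W (f.rTensor W y)) k = f (e y k) := by
    intro f y k
    induction y with
    | zero => simp
    | tmul v w => simp [e, mul_comm]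
    | add y z hy hz => simp only [map_add, Finsupp.add_apply, hy, hz]
  have h1 : ∀ i, TensorProduct.lid K W ((χ i).rTensor W x) = 0 := by
    intro i
    refine hθ _ fun j => ?_
    rw [← hx (i, j)]
    generalize x = y
    induction y with
    | zero => simp
    | tmul v w => simp
    | add y z hy hz => simp only [map_add, hy, hz]
  apply e.injective
  rw [map_zero]
  ext k
  refine hχ _ fun i => ?_
  rw [← key, h1, map_zero, Finsupp.zero_apply]

theorem id : Separating (fun _ : Unit => (LinearMap.id : K →ₗ[K] K)) :=
  fun _ h => h ()

end Separating

end

section Characters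

variable {A ι : Type*} [AddCommGroup A] [Module K A]

theorem tensorForm_map_mul {m : A ⊗[K] A →ₗ[K] A} {f g : A →ₗ[K] K}
    (hf : ∀ a b, f (m (a ⊗ₜ b)) = f a * f b) (hg : ∀ a b, g (m (a ⊗ₜ b)) = g a * g b)
    (x y : A ⊗[K] A) :
    tensorForm f g (TensorProduct.map m m (TensorProduct.tensorTensorTensorComm K A A A A
      (x ⊗ₜ y))) = tensorForm f g x * tensorForm f g y := by
  induction x with
  | zero => simp
  | add x x' hx hx' => simp only [TensorProduct.add_tmul, map_add, hx, hx', add_mul]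
  | tmul a b =>
    induction y with
    | zero => simp
    | add y y' hy hy' => simp only [TensorProduct.tmul_add, map_add, hy, hy', mul_add]
    | tmul c d => simp [hf, hg]; ring

/-- Translates the compatibility of the two coproducts into right distributivity of the operations
on characters: the character `h` sees the product of the two right legs of `δ`, so it is paired once
with `f` and once with `g`. -/
theorem tensorForm_lTensor_mul {m : A ⊗[K] A →ₗ[K] A} (f g : A →ₗ[K] K) {h : A →ₗ[K] K}
    (hh : ∀ a b, h (m (a ⊗ₜ b)) = h a * h b) (δ : A →ₗ[K] A ⊗[K] A) (x : A ⊗[K] A) :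
    tensorForm (tensorForm f g) h (m.lTensor (A ⊗[K] A)
      (TensorProduct.tensorTensorTensorComm K A A A A (TensorProduct.map δ δ x))) =
      tensorForm (tensorForm f h ∘ₗ δ) (tensorForm g h ∘ₗ δ) x := by
  induction x with
  | zero => simp
  | add x x' hx hx' => simp only [map_add, hx, hx']
  | tmul a b =>
    simp only [TensorProduct.map_tmul, tensorForm_tmul, LinearMap.comp_apply]
    generalize δ a = y
    generalize δ b = z
    induction y with
    | zero => simp
    | add x x' hx hx' => simp only [TensorProduct.add_tmul, map_add, hx, hx', add_mul]
    | tmul a b =>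
      induction z with
      | zero => simp
      | add y y' hy hy' => simp only [TensorProduct.tmul_add, map_add, hy, hy', mul_add]
      | tmul c d => simp [hh]; ring

/-- A separating family of characters, closed under the convolution product associated with a
coproduct and containing its counit, ensures the bialgebra axioms. -/
theorem IsCommBialgebra.of_separating {m : A ⊗[K] A →ₗ[K] A} {one : A} {Δ : A →ₗ[K] A ⊗[K] A}
    {ε : A →ₗ[K] K} {χ : ι → A →ₗ[K] K} (hχ : Separating χ)
    (hone : ∀ i, χ i one = 1) (hmul : ∀ i a b, χ i (m (a ⊗ₜ b)) = χ i a * χ i b)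
    (op : ι → ι → ι) (e : ι) (hΔ : ∀ i j, tensorForm (χ i) (χ j) ∘ₗ Δ = χ (op i j))
    (hε : ε = χ e) (assoc : ∀ i j k, χ (op (op i j) k) = χ (op i (op j k)))
    (left : ∀ i, χ (op e i) = χ i) (right : ∀ i, χ (op i e) = χ i) :
    IsCommBialgebra m one Δ ε where
  mul_assoc a b c := hχ.eq fun i => by simp only [hmul, _root_.mul_assoc]
  mul_comm a b := hχ.eq fun i => by simp only [hmul, _root_.mul_comm]
  one_mul a := hχ.eq fun i => by simp only [hmul, hone, _root_.one_mul]
  coassoc a := by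
    refine (hχ.tensor (hχ.tensor hχ)).eq fun p => ?_
    rw [tensorForm_assoc, tensorForm_rTensor, tensorForm_lTensor, hΔ, hΔ, ← LinearMap.comp_apply,
      hΔ, ← LinearMap.comp_apply, hΔ, assoc]
  counit_left a := by
    refine (Separating.id.tensor hχ).eq fun p => ?_
    rw [tensorForm_rTensor, LinearMap.id_comp, hε, ← LinearMap.comp_apply, hΔ, left]
    simp
  counit_right a := by
    refine (hχ.tensor Separating.id).eq fun p => ?_
    rw [tensorForm_lTensor, LinearMap.id_comp, hε, ← LinearMap.comp_apply, hΔ, right]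
    simp
  comul_one := by
    refine (hχ.tensor hχ).eq fun p => ?_
    rw [← LinearMap.comp_apply, hΔ, hone, tensorForm_tmul, hone, hone, _root_.one_mul]
  comul_mul a b := by
    refine (hχ.tensor hχ).eq fun p => ?_
    have h := LinearMap.congr_fun (hΔ p.1 p.2)
    simp only [LinearMap.comp_apply] at h
    rw [tensorForm_map_mul (hmul _) (hmul _), h, h, h, hmul]
  counit_one := by rw [hε, hone]
  counit_mul a b := by rw [hε, hmul]

/-- A separating family of characters, closed under both convolution products and containing both
counits, ensures the double bialgebra axioms. -/
theorem IsDoubleBialgebra.of_separating {D : DoubleBialgebraOps K A} {χ : ι → A →ₗ[K] K}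
    (hχ : Separating χ) (hone : ∀ i, χ i D.one = 1)
    (hmul : ∀ i a b, χ i (D.mul (a ⊗ₜ b)) = χ i a * χ i b)
    (add mul : ι → ι → ι) (zero one : ι)
    (hΔ : ∀ i j, tensorForm (χ i) (χ j) ∘ₗ D.comul = χ (add i j))
    (hδ : ∀ i j, tensorForm (χ i) (χ j) ∘ₗ D.delta = χ (mul i j))
    (hε : D.counit = χ zero) (hε' : D.deltaCounit = χ one)
    (add_assoc : ∀ i j k, χ (add (add i j) k) = χ (add i (add j k)))
    (zero_add : ∀ i, χ (add zero i) = χ i) (add_zero : ∀ i, χ (add i zero) = χ i)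
    (mul_assoc : ∀ i j k, χ (mul (mul i j) k) = χ (mul i (mul j k)))
    (one_mul : ∀ i, χ (mul one i) = χ i) (mul_one : ∀ i, χ (mul i one) = χ i)
    (add_mul : ∀ i j k, χ (mul (add i j) k) = χ (add (mul i k) (mul j k)))
    (zero_mul : ∀ i, χ (mul zero i) = χ zero) : IsDoubleBialgebra D where
  bialgebra_comul := .of_separating hχ hone hmul add zero hΔ hε add_assoc zero_add add_zero
  bialgebra_delta := .of_separating hχ hone hmul mul one hδ hε' mul_assoc one_mul mul_one
  comul_delta a := by
    refine ((hχ.tensor hχ).tensor hχ).eq fun p => ?_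
    rw [tensorForm_rTensor, tensorForm_lTensor_mul _ _ (hmul _), hΔ, hδ, hδ,
      ← LinearMap.comp_apply, ← LinearMap.comp_apply, hΔ, hδ, add_mul]
  counit_delta a := by
    refine (Separating.id.tensor hχ).eq fun p => ?_
    rw [tensorForm_rTensor, LinearMap.id_comp, hε, ← LinearMap.comp_apply, hδ, zero_mul]
    simp [hone]

end Characters

end TensorForm

/-! ## Evaluations of polynomials -/

section Polynomials

variable (K : Type*) [Field K]

/-- The evaluation of polynomials at a natural number. -/
noncomputable def evalNat (n : ℕ) : K[X] →ₗ[K] K :=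
  (Polynomial.aeval (n : K)).toLinearMap

theorem evalNat_apply (n : ℕ) (p : K[X]) : evalNat K n p = p.eval (n : K) := by
  simp [evalNat, Polynomial.aeval_def, Polynomial.eval₂_eq_eval_map]

theorem separating_evalNat [CharZero K] : Separating (evalNat K) := by
  intro p hp
  refine Polynomial.eq_zero_of_infinite_isRoot p ?_
  refine (Set.infinite_range_of_injective (Nat.cast_injective (R := K))).mono ?_
  rintro _ ⟨n, rfl⟩
  rw [Set.mem_ofPred_eq, Polynomial.IsRoot, ← evalNat_apply, hp]

/-- As an algebra morphism, the form composed with a coproduct is determined by its value on `X`. -/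
theorem tensorForm_evalNat (i j : ℕ) :
    tensorForm (evalNat K i) (evalNat K j) =
      (Algebra.TensorProduct.lift (Polynomial.aeval (i : K)) (Polynomial.aeval (j : K))
        (fun _ _ => Commute.all _ _)).toLinearMap := by
  ext
  simp [evalNat]

theorem tensorForm_evalNat_comp_comul (i j : ℕ) :
    tensorForm (evalNat K i) (evalNat K j) ∘ₗ (polyOps K).comul = evalNat K (i + j) := by
  rw [tensorForm_evalNat, polyOps, ← AlgHom.comp_toLinearMap, evalNat]
  congr 1
  ext
  simp

theorem tensorForm_evalNat_comp_delta (i j : ℕ) :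
    tensorForm (evalNat K i) (evalNat K j) ∘ₗ (polyOps K).delta = evalNat K (i * j) := by
  rw [tensorForm_evalNat, polyOps, ← AlgHom.comp_toLinearMap, evalNat]
  congr 1
  ext
  simp

theorem polyOps_counit : (polyOps K).counit = evalNat K 0 := by
  simp [polyOps, evalNat]

theorem polyOps_deltaCounit : (polyOps K).deltaCounit = evalNat K 1 := by
  simp [polyOps, evalNat]

/-- Under evaluation at natural numbers the axioms become the semiring laws of ℕ. -/
theorem isDoubleBialgebra_polyOps [CharZero K] : IsDoubleBialgebra (polyOps K) := by
  refine .of_separating (separating_evalNat K) (fun i => ?_) (fun i a b => ?_) (· + ·) (· * ·) 0 1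
    (tensorForm_evalNat_comp_comul K) (tensorForm_evalNat_comp_delta K) (polyOps_counit K)
    (polyOps_deltaCounit K) ?_ ?_ ?_ ?_ ?_ ?_ ?_ ?_
  · simp [polyOps, evalNat]
  · simp [polyOps, evalNat]
  all_goals intros
  · rw [add_assoc]
  · rw [zero_add]
  · rw [add_zero]
  · rw [mul_assoc]
  · rw [one_mul]
  · rw [mul_one]
  · rw [add_mul]
  · rw [zero_mul]

end Polynomials

/-! ## Sums over strictly increasing maps -/

section OrderEmbeddings

variable {I I' : Type*} [LinearOrder I] [LinearOrder I'] {k l n n' : ℕ}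

noncomputable instance fintypeOrderEmbedding [Finite I] : Fintype (Fin k ↪o I) :=
  have : Finite (Fin k ↪o I) := DFunLike.finite _
  Fintype.ofFinite _

/-- Every map to a linear order is the composition of a surjection onto some `Fin n` and a strictly
increasing map. -/
theorem exists_orderEmbedding_comp_surjective (h : Fin k → I) :
    ∃ n : Fin (k + 1), ∃ (σ : Fin k → Fin n) (F : Fin n ↪o I), Function.Surjective σ ∧ F ∘ σ = h := by
  classical
  let s := Finset.univ.image h
  have hs : s.card < k + 1 := by
    have := Finset.card_image_le (s := Finset.univ) (f := h)
    rw [Finset.card_univ, Fintype.card_fin] at this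
    exact Nat.lt_succ_of_le this
  let e := s.orderIsoOfFin rfl
  have hm : ∀ i, h i ∈ s := fun i => Finset.mem_image_of_mem h (Finset.mem_univ i)
  refine ⟨⟨s.card, hs⟩, fun i => e.symm ⟨h i, hm i⟩,
    e.toOrderEmbedding.trans (OrderEmbedding.subtype _), fun j => ?_, ?_⟩
  · obtain ⟨i, -, hi⟩ := Finset.mem_image.1 (e j).2
    refine ⟨i, ?_⟩
    rw [OrderIso.symm_apply_eq]
    exact Subtype.ext hi
  · ext i
    simp

/-- The factorisation of a map as a surjection onto some `Fin n` followed by a strictly increasing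
map is unique. -/
theorem orderEmbedding_comp_surjective_unique {F : Fin n ↪o I} {F' : Fin n' ↪o I}
    {σ : Fin k → Fin n} {σ' : Fin k → Fin n'} (hσ : Function.Surjective σ)
    (hσ' : Function.Surjective σ') (h : F ∘ σ = F' ∘ σ') : n = n' ∧ F ≍ F' ∧ σ ≍ σ' := by
  -- The common range determines first `n`, then the increasing enumeration `F`, and finally `σ` by
  -- injectivity of `F`.
  have hr : Set.range F = Set.range F' := by
    rw [← hσ.range_comp, h, hσ'.range_comp]
  have hn : n = n' := by
    have h1 := Set.ncard_range_of_injective F.injective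
    have h2 := Set.ncard_range_of_injective F'.injective
    rw [hr, h2] at h1
    simpa using h1.symm
  subst hn
  obtain rfl : F = F' := OrderEmbedding.range_inj.1 hr
  exact ⟨rfl, HEq.rfl, heq_of_eq (F.injective.comp_left h)⟩

/-- Factoring `Fin.append f g` through its image gives a surjection followed by an increasing map;
since the latter reflects the order, the surjection is a quasi-shuffle exactly when `f` and `g` are
strictly increasing. -/
theorem sum_quasiShuffle [Fintype I] {R : Type*} [AddCommMonoid R] [Fintype (QuasiShuffle k l)]
    (Φ : (Fin (k + l) → I) → R) :
    ∑ σ : QuasiShuffle k l, ∑ F : Fin σ.1 ↪o I, Φ (F ∘ σ.2.1) =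
      ∑ f : Fin k ↪o I, ∑ g : Fin l ↪o I, Φ (Fin.append f g) := by
  rw [← Fintype.sum_sigma', ← Fintype.sum_prod_type']
  refine Fintype.sum_bijective (fun x : Σ σ : QuasiShuffle k l, Fin σ.1 ↪o I =>
    (OrderEmbedding.ofStrictMono _ (x.2.strictMono.comp x.1.2.2.2.1),
      OrderEmbedding.ofStrictMono _ (x.2.strictMono.comp x.1.2.2.2.2))) ⟨?_, ?_⟩ _ _ ?_
  · rintro ⟨⟨n, σ, hσ⟩, F⟩ ⟨⟨n', σ', hσ'⟩, F'⟩ h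
    simp only [Prod.mk.injEq] at h
    have h' : F ∘ σ = F' ∘ σ' := by
      funext i
      induction i using Fin.addCases with
      | left i => exact DFunLike.congr_fun h.1 i
      | right i => exact DFunLike.congr_fun h.2 i
    obtain ⟨hn, hF, hs⟩ := orderEmbedding_comp_surjective_unique hσ.1 hσ'.1 h'
    obtain rfl := Fin.ext hn
    cases hF
    cases hs
    rfl
  · rintro ⟨f, g⟩
    obtain ⟨n, σ, F, hσ, h⟩ := exists_orderEmbedding_comp_surjective (Fin.append f g)
    have hf : ∀ i, F (σ (Fin.castAdd l i)) = f i := fun i => by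
      simpa using congrFun h (Fin.castAdd l i)
    have hg : ∀ i, F (σ (Fin.natAdd k i)) = g i := fun i => by
      simpa using congrFun h (Fin.natAdd k i)
    refine ⟨⟨⟨n, σ, hσ, fun i j hij => ?_, fun i j hij => ?_⟩, F⟩, ?_⟩
    · rw [← F.lt_iff_lt, hf, hf]
      exact f.strictMono hij
    · rw [← F.lt_iff_lt, hg, hg]
      exact g.strictMono hij
    · ext i
      · exact hf i
      · exact hg i
  · rintro ⟨⟨n, σ, hσ⟩, F⟩
    congr 1
    funext i
    induction i using Fin.addCases <;> simp

/-- The conditions defining `Adm` say exactly that the pair of composites is strictly increasing for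
the lexicographic order: the first component weakly increases, and ties are broken by the second. -/
theorem sum_adm [Fintype I] [Fintype I'] {R : Type*} [AddCommMonoid R] [Fintype (Adm k)]
    (Φ : (Fin k → I) → (Fin k → I') → R) :
    ∑ σ : Adm k, ∑ F : Fin σ.1.1 ↪o I, ∑ G : Fin σ.1.2 ↪o I', Φ (F ∘ σ.2.1.1) (G ∘ σ.2.1.2) =
      ∑ f : Fin k ↪o I ×ₗ I', Φ (fun i => (ofLex (f i)).1) (fun i => (ofLex (f i)).2) := by
  simp_rw [← Fintype.sum_prod_type']
  rw [← Fintype.sum_sigma']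
  have hmono : ∀ x : Σ σ : Adm k, (Fin σ.1.1 ↪o I) × (Fin σ.1.2 ↪o I'),
      StrictMono fun i => toLex (x.2.1 (x.1.2.1.1 i), x.2.2 (x.1.2.1.2 i)) := by
    rintro ⟨⟨n, σ, h1, h2, h3, h4⟩, F, G⟩ i j hij
    rw [Prod.Lex.toLex_lt_toLex]
    rcases (h3 hij.le).lt_or_eq with h | h
    · exact Or.inl (F.strictMono h)
    · exact Or.inr ⟨congrArg F h, G.strictMono (h4 i j hij h)⟩
  refine Fintype.sum_bijective (fun x => OrderEmbedding.ofStrictMono _ (hmono x)) ⟨?_, ?_⟩ _ _ ?_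
  · rintro ⟨⟨⟨n, m⟩, ⟨σ, τ⟩, hσ⟩, F, G⟩ ⟨⟨⟨n', m'⟩, ⟨σ', τ'⟩, hσ'⟩, F', G'⟩ h
    have h' : ∀ i, F (σ i) = F' (σ' i) ∧ G (τ i) = G' (τ' i) := fun i => by
      simpa using DFunLike.congr_fun h i
    obtain ⟨hn, hF, hs⟩ := orderEmbedding_comp_surjective_unique hσ.1 hσ'.1
      (funext fun i => (h' i).1)
    obtain ⟨hn', hG, ht⟩ := orderEmbedding_comp_surjective_unique hσ.2.1 hσ'.2.1
      (funext fun i => (h' i).2)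
    obtain rfl := Fin.ext hn
    obtain rfl := Fin.ext hn'
    cases hF
    cases hs
    cases hG
    cases ht
    rfl
  · intro f
    obtain ⟨n, σ, F, hσ, h⟩ := exists_orderEmbedding_comp_surjective fun i => (ofLex (f i)).1
    obtain ⟨m, τ, G, hτ, h'⟩ := exists_orderEmbedding_comp_surjective fun i => (ofLex (f i)).2
    have hf : ∀ i, toLex (F (σ i), G (τ i)) = f i := fun i => by
      rw [← Function.comp_apply (f := F), ← Function.comp_apply (f := G), h, h']
      rfl
    have hlt : ∀ i j, i < j → F (σ i) < F (σ j) ∨ F (σ i) = F (σ j) ∧ G (τ i) < G (τ j) := by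
      intro i j hij
      have := f.strictMono hij
      rwa [← hf, ← hf, Prod.Lex.toLex_lt_toLex] at this
    refine ⟨⟨⟨(n, m), (σ, τ), hσ, hτ, fun i j hij => ?_, fun i j hij he => ?_⟩, F, G⟩, ?_⟩
    · rcases hij.lt_or_eq with hij | rfl
      · rw [← F.le_iff_le]
        rcases hlt i j hij with h | h
        · exact h.le
        · exact h.1.le
      · exact le_rfl
    · rcases hlt i j hij with h | h
      · rw [show σ i = σ j from he] at h
        exact absurd h (lt_irrefl _)
      · exact G.lt_iff_lt.1 h.2
    · ext i
      exact hf i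
  · intro x
    rfl

/-- The strictly increasing map to `I ⊕ₗ I'` obtained by gluing strictly increasing maps to `I` and
to `I'`. -/
def glue (h : k = n + l) (f : Fin n ↪o I) (g : Fin l ↪o I') : Fin k ↪o I ⊕ₗ I' :=
  OrderEmbedding.ofStrictMono
    (fun i => Fin.append (fun i => toLex (Sum.inl (f i))) (fun i => toLex (Sum.inr (g i)))
      (Fin.cast h i)) <| by
    subst h
    intro i j hij
    induction i using Fin.addCases with
    | left i =>
      induction j using Fin.addCases with
      | left j => simpa using f.strictMono (show i < j from hij)
      | right j => simp
    | right i =>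
      induction j using Fin.addCases with
      | left j =>
        have := i.is_lt
        have := j.is_lt
        simp only [Fin.lt_def, Fin.val_natAdd, Fin.val_castAdd] at hij
        omega
      | right j => simpa using hij

@[simp]
theorem glue_castAdd (f : Fin n ↪o I) (g : Fin l ↪o I') (i : Fin n) :
    glue rfl f g (Fin.castAdd l i) = toLex (Sum.inl (f i)) := by
  simp [glue]

@[simp]
theorem glue_natAdd (f : Fin n ↪o I) (g : Fin l ↪o I') (i : Fin l) :
    glue rfl f g (Fin.natAdd n i) = toLex (Sum.inr (g i)) := by
  simp [glue]

theorem isLeft_glue (h : k = n + l) (f : Fin n ↪o I) (g : Fin l ↪o I') (i : Fin k) :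
    (ofLex (glue h f g i)).isLeft ↔ (i : ℕ) < n := by
  subst h
  induction i using Fin.addCases <;> simp

/-- The cut is recovered as the number of indices sent to the left summand. -/
theorem glue_unique {l' : ℕ} {h : k = n + l} {h' : k = n' + l'} {f : Fin n ↪o I}
    {f' : Fin n' ↪o I} {g : Fin l ↪o I'} {g' : Fin l' ↪o I'}
    (e : glue h f g = glue h' f' g') : n = n' ∧ l = l' ∧ f ≍ f' ∧ g ≍ g' := by
  have key : ∀ i : Fin k, (i : ℕ) < n ↔ (i : ℕ) < n' := fun i => by
    rw [← isLeft_glue h f g, ← isLeft_glue h' f' g', e]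
  have hn : n = n' := by
    rcases lt_trichotomy n n' with hlt | heq | hlt
    · have := key ⟨n, by omega⟩
      simp only [lt_irrefl, false_iff] at this
      exact absurd hlt this
    · exact heq
    · have := key ⟨n', by omega⟩
      simp only [lt_irrefl, iff_false] at this
      exact absurd hlt this
  subst hn
  obtain rfl : l = l' := by omega
  subst h
  refine ⟨rfl, rfl, heq_of_eq ?_, heq_of_eq ?_⟩ <;> ext i
  · have := DFunLike.congr_fun e (Fin.castAdd l i)
    simpa using this
  · have := DFunLike.congr_fun e (Fin.natAdd n i)
    simpa using this

theorem exists_eq_glue (f : Fin k ↪o I ⊕ₗ I') :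
    ∃ (n l : ℕ) (h : k = n + l) (f₁ : Fin n ↪o I) (f₂ : Fin l ↪o I'), f = glue h f₁ f₂ := by
  classical
  have hex : ∃ n, ∀ i : Fin k, n ≤ (i : ℕ) → ¬ (ofLex (f i)).isLeft :=
    ⟨k, fun i hi => absurd i.is_lt hi.not_gt⟩
  -- The cut `n` is the least index from which no value lies in `I`.
  obtain ⟨n, hn, hmin⟩ : ∃ n, (∀ i : Fin k, n ≤ (i : ℕ) → ¬ (ofLex (f i)).isLeft) ∧
      ∀ m < n, ¬ ∀ i : Fin k, m ≤ (i : ℕ) → ¬ (ofLex (f i)).isLeft :=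
    ⟨Nat.find hex, Nat.find_spec hex, fun m hm => Nat.find_min hex hm⟩
  have hnk : n ≤ k := by
    by_contra! h
    exact hmin k h fun i hi => absurd i.is_lt hi.not_gt
  obtain ⟨l, rfl⟩ := Nat.exists_eq_add_of_le hnk
  have h1 : ∀ i : Fin n, ∃ x, f (Fin.castAdd l i) = toLex (Sum.inl x) := by
    intro i
    by_contra! hi
    -- If the value at `i < n` were not in `I`, no later value could be, by monotonicity, against
    -- the minimality of `n`.
    refine hmin i i.is_lt fun j hj hleft => ?_
    obtain ⟨y, hy⟩ := Sum.isLeft_iff.1 hleft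
    have hle : f (Fin.castAdd l i) ≤ f j := f.monotone hj
    rcases hfi : ofLex (f (Fin.castAdd l i)) with x | x
    · exact hi x hfi
    · rw [show f j = toLex (Sum.inl y) from hy,
        show f (Fin.castAdd l i) = toLex (Sum.inr x) from hfi] at hle
      exact Sum.Lex.not_inr_le_inl hle
  have h2 : ∀ i : Fin l, ∃ x, f (Fin.natAdd n i) = toLex (Sum.inr x) := by
    intro i
    have := hn (Fin.natAdd n i) (by simp)
    rw [Sum.not_isLeft, Sum.isRight_iff] at this
    exact this
  choose f₁ hf₁ using h1
  choose f₂ hf₂ using h2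
  refine ⟨n, l, rfl, OrderEmbedding.ofStrictMono f₁ fun i j hij => ?_,
    OrderEmbedding.ofStrictMono f₂ fun i j hij => ?_, ?_⟩
  · rw [← Sum.Lex.inl_lt_inl_iff (β := I'), ← hf₁, ← hf₁]
    exact f.strictMono (show Fin.castAdd l i < Fin.castAdd l j from hij)
  · rw [← Sum.Lex.inr_lt_inr_iff (α := I), ← hf₂, ← hf₂]
    exact f.strictMono (by simpa using hij)
  · ext i
    induction i using Fin.addCases <;> simp [hf₁, hf₂] <;> rfl

end OrderEmbeddings

/-! ## Evaluation of packed matrices at matrices -/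

/-- A matrix with coefficients in `R` whose rows and columns are indexed by finite linear orders. -/
structure OrderedMatrix (R : Type*) where
  Row : Type
  Col : Type
  [linearOrderRow : LinearOrder Row]
  [linearOrderCol : LinearOrder Col]
  [fintypeRow : Fintype Row]
  [fintypeCol : Fintype Col]
  entry : Row → Col → R

namespace OrderedMatrix

attribute [instance] linearOrderRow linearOrderCol fintypeRow fintypeCol

variable {R : Type*} [CommRing R]

/-- The block diagonal sum. -/
def directSum (a b : OrderedMatrix R) : OrderedMatrix R where
  Row := a.Row ⊕ₗ b.Row
  Col := a.Col ⊕ₗ b.Col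
  entry i j := Matrix.fromBlocks a.entry 0 0 b.entry (ofLex i) (ofLex j)

/-- The Kronecker product, the indices being ordered lexicographically. -/
def kronecker (a b : OrderedMatrix R) : OrderedMatrix R where
  Row := a.Row ×ₗ b.Row
  Col := a.Col ×ₗ b.Col
  entry i j := a.entry (ofLex i).1 (ofLex j).1 * b.entry (ofLex i).2 (ofLex j).2

/-- The identity matrix of size `n`. -/
def identity (R : Type*) [CommRing R] (n : ℕ) : OrderedMatrix R where
  Row := Fin n
  Col := Fin n
  entry i j := if i = j then 1 else 0

end OrderedMatrix

namespace PackedMatrix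

variable {R : Type*} [CommRing R] {I J : Type*}

/-- The monomial in the coefficients of `a` with exponents the coefficients of `A`, the rows and
columns of `A` being sent to those of `a` by `f` and `g`. -/
def weight {k l : ℕ} (A : Matrix (Fin k) (Fin l) ℕ) (a : I → J → R) (f : Fin k → I)
    (g : Fin l → J) : R :=
  ∏ r, ∏ c, a (f r) (g c) ^ A r c

/-- The product by `mu` adds the coefficients sent to the same place, and adding exponents
multiplies powers. -/
theorem weight_mu {k l n m : ℕ} (A : Matrix (Fin k) (Fin l) ℕ) (σ : Fin k → Fin n)
    (τ : Fin l → Fin m) (a : I → J → R) (F : Fin n → I) (G : Fin m → J) :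
    weight (mu σ * A * (mu τ)ᵀ) a F G = weight A a (F ∘ σ) (G ∘ τ) := by
  -- For a fixed source position `q`, only the factor at its image differs from 1.
  let w : Fin n × Fin m → Fin l × Fin k → R := fun p q =>
    a (F p.1) (G p.2) ^ (if p.1 = σ q.2 ∧ p.2 = τ q.1 then A q.2 q.1 else 0)
  have h1 : weight (mu σ * A * (mu τ)ᵀ) a F G = ∏ p, ∏ q, w p q := by
    simp only [weight, mu_mul_mul_apply, ← Finset.prod_pow_eq_pow_sum, Fintype.prod_prod_type, w]
  have h2 : weight A a (F ∘ σ) (G ∘ τ) =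
      ∏ q : Fin l × Fin k, a (F (σ q.2)) (G (τ q.1)) ^ A q.2 q.1 := by
    rw [weight, Finset.prod_comm, Fintype.prod_prod_type]
    rfl
  rw [h1, h2, Finset.prod_comm]
  refine Finset.prod_congr rfl fun q _ => ?_
  rw [Finset.prod_eq_single (σ q.2, τ q.1)]
  · simp [w]
  · rintro ⟨i, j⟩ - h
    simp only [w]
    rw [if_neg (fun h' => h (Prod.ext h'.1 h'.2)), pow_zero]
  · simp

theorem weight_block (M N : PackedMatrix) (a : I → J → R) (f : Fin (M.row + N.row) → I)
    (g : Fin (M.col + N.col) → J) :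
    weight (M.block N).mat a f g =
      weight M.mat a (fun i => f (Fin.castAdd _ i)) (fun j => g (Fin.castAdd _ j)) *
        weight N.mat a (fun i => f (Fin.natAdd _ i)) (fun j => g (Fin.natAdd _ j)) := by
  change ∏ r : Fin (M.row + N.row), ∏ c : Fin (M.col + N.col), a (f r) (g c) ^ _ = _
  simp [Fin.prod_univ_add, weight, block]

theorem weight_mul {k l : ℕ} (A : Matrix (Fin k) (Fin l) ℕ) {I' J' : Type*} (a : I → J → R)
    (b : I' → J' → R) (f : Fin k → I × I') (g : Fin l → J × J') :
    weight A (fun i j => a i.1 j.1 * b i.2 j.2) f g =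
      weight A a (fun i => (f i).1) (fun j => (g j).1) *
        weight A b (fun i => (f i).2) (fun j => (g j).2) := by
  simp only [weight, mul_pow, Finset.prod_mul_distrib]

theorem block_injective_of_row_col {p q p' q' : PackedMatrix} (h : p.block q = p'.block q')
    (hr : p.row = p'.row) (hc : p.col = p'.col) : p = p' ∧ q = q' := by
  obtain ⟨k, l, A, hA, hA'⟩ := p
  obtain ⟨k', l', A', hB, hB'⟩ := p'
  obtain ⟨m, n, B, hC, hC'⟩ := q
  obtain ⟨m', n', B', hD, hD'⟩ := q'
  dsimp only at hr hc
  subst hr hc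
  have hr := congrArg PackedMatrix.row h
  have hc := congrArg PackedMatrix.col h
  simp only [block, Nat.add_left_cancel_iff] at hr hc
  subst hr hc
  simp only [block, PackedMatrix.mk.injEq, heq_eq_eq, true_and, EmbeddingLike.apply_eq_iff_eq,
    Matrix.fromBlocks_inj] at h
  obtain ⟨rfl, -, -, rfl⟩ := h
  exact ⟨rfl, rfl⟩

/-- The value at `a` of the series attached to a matrix. -/
noncomputable def evalAt {k l : ℕ} (a : OrderedMatrix R) (A : Matrix (Fin k) (Fin l) ℕ) : R :=
  ∑ f : Fin k ↪o a.Row, ∑ g : Fin l ↪o a.Col, weight A a.entry f g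

theorem evalAt_congr {k l : ℕ} {a b : OrderedMatrix R} (e : a.Row ≃o b.Row) (e' : a.Col ≃o b.Col)
    (h : ∀ i j, a.entry i j = b.entry (e i) (e' j)) (A : Matrix (Fin k) (Fin l) ℕ) :
    evalAt a A = evalAt b A := by
  have key : ∀ {I I' : Type} [LinearOrder I] [LinearOrder I'] [Fintype I] [Fintype I'] {k : ℕ}
      (u : I ≃o I'), Function.Bijective fun f : Fin k ↪o I => f.trans u.toOrderEmbedding := by
    intro I I' _ _ _ _ k u
    refine Function.bijective_iff_has_inverse.2
      ⟨fun f => f.trans u.symm.toOrderEmbedding, fun f => ?_, fun f => ?_⟩ <;> ext <;> simp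
  refine Fintype.sum_bijective _ (key e) _ _ fun f => Fintype.sum_bijective _ (key e') _ _ fun g => ?_
  simp [weight, h]

theorem evalAt_zero (a : OrderedMatrix R) (A : Matrix (Fin 0) (Fin 0) ℕ) : evalAt a A = 1 := by
  have key : ∀ {I : Type} [LinearOrder I], Nonempty (Unique (Fin 0 ↪o I)) := fun {I} _ =>
    ⟨⟨⟨OrderEmbedding.ofStrictMono Fin.elim0 fun i => i.elim0⟩, fun f => by
      ext i
      exact i.elim0⟩⟩
  obtain ⟨h1⟩ := key (I := a.Row)
  obtain ⟨h2⟩ := key (I := a.Col)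
  rw [evalAt, Fintype.sum_unique, Fintype.sum_unique, weight, Fin.prod_univ_zero]

theorem sum_evalAt_quasiShuffle {k k' l l' : ℕ} [Fintype (QuasiShuffle k k')]
    [Fintype (QuasiShuffle l l')] (a : OrderedMatrix R)
    (C : Matrix (Fin (k + k')) (Fin (l + l')) ℕ) :
    ∑ σ : QuasiShuffle k k', ∑ τ : QuasiShuffle l l', evalAt a (mu σ.2.1 * C * (mu τ.2.1)ᵀ) =
      ∑ f : Fin k ↪o a.Row, ∑ f' : Fin k' ↪o a.Row, ∑ g : Fin l ↪o a.Col, ∑ g' : Fin l' ↪o a.Col,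
        weight C a.entry (Fin.append f f') (Fin.append g g') := by
  calc
    _ = ∑ σ : QuasiShuffle k k', ∑ F : Fin σ.1 ↪o a.Row, ∑ τ : QuasiShuffle l l',
        ∑ G : Fin τ.1 ↪o a.Col, weight C a.entry (F ∘ σ.2.1) (G ∘ τ.2.1) := by
      refine Finset.sum_congr rfl fun σ _ => ?_
      rw [Finset.sum_comm]
      refine Finset.sum_congr rfl fun τ _ => ?_
      simp only [evalAt, weight_mu]
    _ = _ := by
      rw [sum_quasiShuffle fun f => ∑ τ : QuasiShuffle l l', ∑ G : Fin τ.1 ↪o a.Col,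
        weight C a.entry f (G ∘ τ.2.1)]
      refine Finset.sum_congr rfl fun f _ => Finset.sum_congr rfl fun f' _ => ?_
      exact sum_quasiShuffle fun g => weight C a.entry _ g

theorem sum_evalAt_adm {k l : ℕ} [Fintype (Adm k)] [Fintype (Adm l)] (a b : OrderedMatrix R)
    (A : Matrix (Fin k) (Fin l) ℕ) :
    ∑ σ : Adm k, ∑ τ : Adm l, evalAt a (mu σ.2.1.1 * A * (mu τ.2.1.1)ᵀ) *
      evalAt b (mu σ.2.1.2 * A * (mu τ.2.1.2)ᵀ) = evalAt (a.kronecker b) A := by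
  calc
    _ = ∑ σ : Adm k, ∑ F : Fin σ.1.1 ↪o a.Row, ∑ F' : Fin σ.1.2 ↪o b.Row, ∑ τ : Adm l,
          ∑ G : Fin τ.1.1 ↪o a.Col, ∑ G' : Fin τ.1.2 ↪o b.Col,
            weight A a.entry (F ∘ σ.2.1.1) (G ∘ τ.2.1.1) *
              weight A b.entry (F' ∘ σ.2.1.2) (G' ∘ τ.2.1.2) := by
      refine Finset.sum_congr rfl fun σ _ => ?_
      symm
      refine (Finset.sum_congr rfl fun F _ => Finset.sum_comm).trans ?_
      rw [Finset.sum_comm]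
      refine Finset.sum_congr rfl fun τ _ => ?_
      simp only [evalAt, weight_mu, Finset.sum_mul_sum]
    _ = ∑ f : Fin k ↪o a.Row ×ₗ b.Row, ∑ τ : Adm l,
          ∑ G : Fin τ.1.1 ↪o a.Col, ∑ G' : Fin τ.1.2 ↪o b.Col,
            weight A a.entry (fun i => (ofLex (f i)).1) (G ∘ τ.2.1.1) *
              weight A b.entry (fun i => (ofLex (f i)).2) (G' ∘ τ.2.1.2) :=
      sum_adm fun f f' => ∑ τ : Adm l, ∑ G : Fin τ.1.1 ↪o a.Col, ∑ G' : Fin τ.1.2 ↪o b.Col,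
        weight A a.entry f (G ∘ τ.2.1.1) * weight A b.entry f' (G' ∘ τ.2.1.2)
    _ = ∑ f : Fin k ↪o a.Row ×ₗ b.Row, ∑ g : Fin l ↪o a.Col ×ₗ b.Col,
          weight A a.entry (fun i => (ofLex (f i)).1) (fun j => (ofLex (g j)).1) *
            weight A b.entry (fun i => (ofLex (f i)).2) (fun j => (ofLex (g j)).2) :=
      Finset.sum_congr rfl fun f _ => sum_adm fun g g' =>
        weight A a.entry (fun i => (ofLex (f i)).1) g *
          weight A b.entry (fun i => (ofLex (f i)).2) g'
    _ = _ := Finset.sum_congr rfl fun f _ => Finset.sum_congr rfl fun g _ =>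
      (weight_mul A a.entry b.entry (fun i => ofLex (f i)) (fun j => ofLex (g j))).symm

theorem sum_evalAt_push_quasiShuffle (a : OrderedMatrix R) (M N : PackedMatrix)
    [Fintype (QuasiShuffle M.row N.row)] [Fintype (QuasiShuffle M.col N.col)] :
    ∑ σ : QuasiShuffle M.row N.row, ∑ τ : QuasiShuffle M.col N.col,
      evalAt a ((M.block N).push σ.2.1 τ.2.1 σ.2.2.1 τ.2.2.1).mat =
        evalAt a M.mat * evalAt a N.mat := by
  refine (sum_evalAt_quasiShuffle a (M.block N).mat).trans ?_
  rw [evalAt, evalAt, Finset.sum_mul_sum]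
  refine Finset.sum_congr rfl fun f _ => Finset.sum_congr rfl fun f' _ => ?_
  rw [Finset.sum_mul_sum]
  refine Finset.sum_congr rfl fun g _ => Finset.sum_congr rfl fun g' _ => ?_
  refine (weight_block M N _ _ _).trans ?_
  simp only [Fin.append_left, Fin.append_right]

/-- A nonzero coefficient of `M` placed in an off-diagonal block of the direct sum contributes a
factor 0. A surviving placement thus cuts the rows and columns so that `M` is block diagonal; the
blocks stay packed because the off-diagonal parts vanish. -/
theorem exists_block_of_weight_directSum_ne_zero {a b : OrderedMatrix R} (M : PackedMatrix)
    (f : Fin M.row ↪o a.Row ⊕ₗ b.Row) (g : Fin M.col ↪o a.Col ⊕ₗ b.Col)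
    (h : weight M.mat (a.directSum b).entry f g ≠ 0) :
    ∃ (p q : PackedMatrix) (hr : M.row = p.row + q.row) (hc : M.col = p.col + q.col)
      (f₁ : Fin p.row ↪o a.Row) (f₂ : Fin q.row ↪o b.Row)
      (g₁ : Fin p.col ↪o a.Col) (g₂ : Fin q.col ↪o b.Col),
      M = p.block q ∧ f = glue hr f₁ f₂ ∧ g = glue hc g₁ g₂ := by
  obtain ⟨row, col, A, hA, hA'⟩ := M
  obtain ⟨n, l, hr, f₁, f₂, rfl⟩ := exists_eq_glue f
  obtain ⟨n', l', hc, g₁, g₂, rfl⟩ := exists_eq_glue g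
  dsimp only at hr hc
  subst hr hc
  have hz : ∀ i j, (a.directSum b).entry (glue rfl f₁ f₂ i) (glue rfl g₁ g₂ j) = 0 → A i j = 0 := by
    intro i j hij
    by_contra hA0
    refine h (Finset.prod_eq_zero (Finset.mem_univ i) (Finset.prod_eq_zero (Finset.mem_univ j) ?_))
    dsimp only
    rw [hij, zero_pow hA0]
  have h12 : ∀ i j, A (Fin.castAdd l i) (Fin.natAdd n' j) = 0 := fun i j =>
    hz _ _ (by rw [glue_castAdd, glue_natAdd]; rfl)
  have h21 : ∀ i j, A (Fin.natAdd n i) (Fin.castAdd l' j) = 0 := fun i j =>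
    hz _ _ (by rw [glue_castAdd, glue_natAdd]; rfl)
  refine ⟨⟨n, n', fun i j => A (Fin.castAdd l i) (Fin.castAdd l' j), fun i => ?_, fun j => ?_⟩,
    ⟨l, l', fun i j => A (Fin.natAdd n i) (Fin.natAdd n' j), fun i => ?_, fun j => ?_⟩,
    rfl, rfl, f₁, f₂, g₁, g₂, ?_, rfl, rfl⟩
  · obtain ⟨j, hj⟩ := hA (Fin.castAdd l i)
    induction j using Fin.addCases with
    | left j => exact ⟨j, hj⟩
    | right j => exact absurd (h12 i j) hj
  · obtain ⟨i, hi⟩ := hA' (Fin.castAdd l' j)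
    induction i using Fin.addCases with
    | left i => exact ⟨i, hi⟩
    | right i => exact absurd (h21 i j) hi
  · obtain ⟨j, hj⟩ := hA (Fin.natAdd n i)
    induction j using Fin.addCases with
    | left j => exact absurd (h21 i j) hj
    | right j => exact ⟨j, hj⟩
  · obtain ⟨i, hi⟩ := hA' (Fin.natAdd n' j)
    induction i using Fin.addCases with
    | left i => exact absurd (h12 i j) hi
    | right i => exact ⟨i, hi⟩
  · simp only [block, PackedMatrix.mk.injEq, heq_eq_eq, true_and]
    ext i j
    induction i using Fin.addCases <;> induction j using Fin.addCases <;> simp [h12, h21] <;> rfl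

theorem sum_evalAt_block (a b : OrderedMatrix R) (M : PackedMatrix) :
    ∑ p ∈ M.finite_block_eq.toFinset, evalAt a p.1.mat * evalAt b p.2.mat =
      evalAt (a.directSum b) M.mat := by
  let T : PackedMatrix × PackedMatrix → Type := fun p =>
    ((Fin p.1.row ↪o a.Row) × (Fin p.2.row ↪o b.Row)) ×
      ((Fin p.1.col ↪o a.Col) × (Fin p.2.col ↪o b.Col))
  have h1 : ∀ p ∈ M.finite_block_eq.toFinset, evalAt a p.1.mat * evalAt b p.2.mat =
      ∑ x : T p, weight p.1.mat a.entry x.1.1 x.2.1 * weight p.2.mat b.entry x.1.2 x.2.2 := by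
    intro p _
    simp only [T, Fintype.sum_prod_type, evalAt, Finset.sum_mul_sum]
  have hM : ∀ x ∈ M.finite_block_eq.toFinset.sigma fun p => (Finset.univ : Finset (T p)),
      M = x.1.1.block x.1.2 := fun x hx => by
    simpa using (Finset.mem_sigma.1 hx).1
  let e : {x // x ∈ M.finite_block_eq.toFinset.sigma fun p => (Finset.univ : Finset (T p))} →
      (Fin M.row ↪o a.Row ⊕ₗ b.Row) × (Fin M.col ↪o a.Col ⊕ₗ b.Col) := fun x =>
    (glue (congrArg row (hM _ x.2)) x.1.2.1.1 x.1.2.1.2,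
      glue (congrArg col (hM _ x.2)) x.1.2.2.1 x.1.2.2.2)
  rw [Finset.sum_congr rfl h1, Finset.sum_sigma', ← Finset.sum_attach, evalAt,
    ← Fintype.sum_prod_type']
  -- Gluing is injective on factorisations with placements of both factors; placements outside its
  -- image have weight 0.
  refine Finset.sum_of_injOn e ?_ (fun _ _ => Finset.mem_coe.2 (Finset.mem_univ _)) ?_ ?_
  · rintro ⟨⟨⟨p, q⟩, ⟨f₁, f₂⟩, ⟨g₁, g₂⟩⟩, hx⟩ - ⟨⟨⟨p', q'⟩, ⟨f₁', f₂'⟩, ⟨g₁', g₂'⟩⟩, hx'⟩ - h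
    obtain ⟨hr, hr', hf₁, hf₂⟩ := glue_unique (congrArg Prod.fst h)
    obtain ⟨hc, hc', hg₁, hg₂⟩ := glue_unique (congrArg Prod.snd h)
    obtain ⟨h, h'⟩ := block_injective_of_row_col ((hM _ hx).symm.trans (hM _ hx')) hr hc
    dsimp only at h h' f₁ f₁' f₂ f₂' g₁ g₁' g₂ g₂'
    subst h h'
    cases hf₁
    cases hf₂
    cases hg₁
    cases hg₂
    rfl
  · rintro ⟨f, g⟩ - hfg
    by_contra hne
    obtain ⟨p, q, hr, hc, f₁, f₂, g₁, g₂, h, rfl, rfl⟩ :=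
      exists_block_of_weight_directSum_ne_zero M f g hne
    exact hfg ⟨⟨⟨(p, q), (f₁, f₂), (g₁, g₂)⟩, by simpa using h⟩,
      Finset.mem_coe.2 (Finset.mem_attach _ _), rfl⟩
  · rintro ⟨⟨⟨p, q⟩, ⟨f₁, f₂⟩, ⟨g₁, g₂⟩⟩, hx⟩ -
    obtain rfl : M = p.block q := hM _ hx
    refine Eq.trans ?_ (weight_block p q _ _ _).symm
    congr 1
    · refine Finset.prod_congr rfl fun r _ => Finset.prod_congr rfl fun c _ => ?_
      refine congrArg (· ^ _) ?_
      change _ = (a.directSum b).entry (glue rfl f₁ f₂ _) (glue rfl g₁ g₂ _)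
      rw [glue_castAdd, glue_castAdd]
      rfl
    · refine Finset.prod_congr rfl fun r _ => Finset.prod_congr rfl fun c _ => ?_
      refine congrArg (· ^ _) ?_
      change _ = (a.directSum b).entry (glue rfl f₁ f₂ _) (glue rfl g₁ g₂ _)
      rw [glue_natAdd, glue_natAdd]
      rfl

end PackedMatrix

/-! ### Isomorphisms of ordered matrices and their semiring laws -/

namespace OrderedMatrix

variable {R : Type*} [CommRing R]

/-- Two matrices are isomorphic if they agree up to increasing relabellings of rows and columns. -/
def Iso (a b : OrderedMatrix R) : Prop :=
  ∃ (e : a.Row ≃o b.Row) (e' : a.Col ≃o b.Col), ∀ i j, a.entry i j = b.entry (e i) (e' j)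

theorem directSum_assoc (a b c : OrderedMatrix R) :
    ((a.directSum b).directSum c).Iso (a.directSum (b.directSum c)) := by
  refine ⟨OrderIso.sumLexAssoc _ _ _, OrderIso.sumLexAssoc _ _ _, ?_⟩
  rintro ((i | i) | i) ((j | j) | j) <;> rfl

theorem kronecker_assoc (a b c : OrderedMatrix R) :
    ((a.kronecker b).kronecker c).Iso (a.kronecker (b.kronecker c)) :=
  ⟨Prod.Lex.prodLexAssoc _ _ _, Prod.Lex.prodLexAssoc _ _ _, fun _ _ => mul_assoc _ _ _⟩

/-- Only this side is distributive in general: lexicographic order lists all indices over `a` before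
those over `b`, whereas a direct sum in the second factor would be interleaved. -/
theorem directSum_kronecker (a b c : OrderedMatrix R) :
    ((a.directSum b).kronecker c).Iso ((a.kronecker c).directSum (b.kronecker c)) := by
  refine ⟨Prod.Lex.sumLexProdLexDistrib _ _ _, Prod.Lex.sumLexProdLexDistrib _ _ _, ?_⟩
  rintro ⟨i | i, k⟩ ⟨j | j, l⟩
  · rfl
  · exact zero_mul _
  · exact zero_mul _
  · rfl

theorem identity_zero_directSum (a : OrderedMatrix R) : ((identity R 0).directSum a).Iso a := by
  have : IsEmpty (identity R 0).Row := inferInstanceAs (IsEmpty (Fin 0))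
  have : IsEmpty (identity R 0).Col := inferInstanceAs (IsEmpty (Fin 0))
  refine ⟨OrderIso.emptySumLex, OrderIso.emptySumLex, ?_⟩
  rintro (i | i) (j | j)
  · exact i.elim0
  · exact i.elim0
  · exact j.elim0
  · rfl

theorem directSum_identity_zero (a : OrderedMatrix R) : (a.directSum (identity R 0)).Iso a := by
  have : IsEmpty (identity R 0).Row := inferInstanceAs (IsEmpty (Fin 0))
  have : IsEmpty (identity R 0).Col := inferInstanceAs (IsEmpty (Fin 0))
  refine ⟨OrderIso.sumLexEmpty, OrderIso.sumLexEmpty, ?_⟩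
  rintro (i | i) (j | j)
  · rfl
  · exact j.elim0
  · exact i.elim0
  · exact i.elim0

theorem identity_one_kronecker (a : OrderedMatrix R) : ((identity R 1).kronecker a).Iso a := by
  let : Unique (identity R 1).Row := inferInstanceAs (Unique (Fin 1))
  let : Unique (identity R 1).Col := inferInstanceAs (Unique (Fin 1))
  refine ⟨Prod.Lex.uniqueProd _ _, Prod.Lex.uniqueProd _ _, ?_⟩
  rintro ⟨i, i'⟩ ⟨j, j'⟩
  have h : (identity R 1).entry i j = 1 := if_pos (Subsingleton.elim (α := Fin 1) i j)
  change (identity R 1).entry i j * _ = _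
  rw [h, one_mul]
  rfl

theorem kronecker_identity_one (a : OrderedMatrix R) : (a.kronecker (identity R 1)).Iso a := by
  let : Unique (identity R 1).Row := inferInstanceAs (Unique (Fin 1))
  let : Unique (identity R 1).Col := inferInstanceAs (Unique (Fin 1))
  refine ⟨Prod.Lex.prodUnique _ _, Prod.Lex.prodUnique _ _, ?_⟩
  rintro ⟨i, i'⟩ ⟨j, j'⟩
  have h : (identity R 1).entry i' j' = 1 := if_pos (Subsingleton.elim (α := Fin 1) i' j')
  change _ * (identity R 1).entry i' j' = _
  rw [h, mul_one]
  rfl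

theorem identity_zero_kronecker (a : OrderedMatrix R) :
    ((identity R 0).kronecker a).Iso (identity R 0) := by
  have key : ∀ {I : Type} [LinearOrder I], Nonempty (Fin 0 ×ₗ I ≃o Fin 0) := fun {I} _ =>
    ⟨⟨⟨fun x => (ofLex x).1, fun x => x.elim0, fun x => (ofLex x).1.elim0, fun x => x.elim0⟩,
      fun {x} => (ofLex x).1.elim0⟩⟩
  obtain ⟨e⟩ := key (I := a.Row)
  obtain ⟨e'⟩ := key (I := a.Col)
  exact ⟨e, e', fun i => (ofLex i).1.elim0⟩

/-- A matrix with coefficients `δ i j` is isomorphic to an identity matrix. -/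
theorem iso_identity {I : Type} [LinearOrder I] [Fintype I] (n : ℕ) (h : Fintype.card I = n)
    (u : I → I → R) (h1 : ∀ i, u i i = 1) (h0 : ∀ i j, i ≠ j → u i j = 0) :
    OrderedMatrix.Iso ⟨I, I, u⟩ (identity R n) := by
  let e : I ≃o Fin n := (Fintype.orderIsoFinOfCardEq I h).symm
  refine ⟨e, e, fun i j => ?_⟩
  change u i j = if e i = e j then 1 else 0
  split_ifs with hij
  · obtain rfl : i = j := e.injective hij
    exact h1 i
  · exact h0 i j fun h => hij (congrArg e h)

theorem identity_directSum_identity (n m : ℕ) :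
    ((identity R n).directSum (identity R m)).Iso (identity R (n + m)) := by
  refine iso_identity (I := Fin n ⊕ₗ Fin m) (n + m) ?_ _ ?_ ?_
  · change Fintype.card (Fin n ⊕ Fin m) = _
    simp
  · rintro (i | i) <;> exact if_pos rfl
  · rintro (i | i) (j | j) hij
    · exact if_neg fun h => hij (congrArg Sum.inl h)
    · rfl
    · rfl
    · exact if_neg fun h => hij (congrArg Sum.inr h)

theorem identity_kronecker_identity (n m : ℕ) :
    ((identity R n).kronecker (identity R m)).Iso (identity R (n * m)) := by
  refine iso_identity (I := Fin n ×ₗ Fin m) (n * m) ?_ _ ?_ ?_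
  · change Fintype.card (Fin n × Fin m) = _
    simp
  · rintro ⟨i, i'⟩
    change (if i = i then (1 : R) else 0) * (if i' = i' then 1 else 0) = 1
    rw [if_pos rfl, if_pos rfl, one_mul]
  · rintro ⟨i, i'⟩ ⟨j, j'⟩ hij
    change (if i = j then (1 : R) else 0) * (if i' = j' then 1 else 0) = 0
    by_cases h : i = j
    · by_cases h' : i' = j'
      · subst h h'
        exact absurd rfl hij
      · rw [if_neg h', mul_zero]
    · rw [if_neg h, zero_mul]

end OrderedMatrix

namespace PackedMatrix

variable {R : Type*} [CommRing R]

theorem evalAt_eq_of_iso {k l : ℕ} {a b : OrderedMatrix R} (h : a.Iso b)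
    (A : Matrix (Fin k) (Fin l) ℕ) : evalAt a A = evalAt b A :=
  let ⟨e, e', he⟩ := h
  evalAt_congr e e' he A

/-! ### Evaluation at identity matrices -/

theorem eq_empty_of_row_eq_zero {M : PackedMatrix} (h : M.row = 0) : M = empty := by
  obtain ⟨k, l, A, h1, h2⟩ := M
  dsimp only at h
  subst h
  have hl : l = 0 := by
    by_contra hl
    obtain ⟨i, -⟩ := h2 ⟨0, Nat.pos_of_ne_zero hl⟩
    exact i.elim0
  subst hl
  simp only [empty, PackedMatrix.mk.injEq, heq_eq_eq, true_and]
  ext i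
  exact i.elim0

theorem weight_identity {k l : ℕ} (A : Matrix (Fin k) (Fin l) ℕ) (n : ℕ) (f : Fin k → Fin n)
    (g : Fin l → Fin n) [Decidable (∀ r c, A r c ≠ 0 → f r = g c)] :
    weight A (OrderedMatrix.identity R n).entry f g =
      if ∀ r c, A r c ≠ 0 → f r = g c then 1 else 0 := by
  change ∏ r, ∏ c, (if f r = g c then (1 : R) else 0) ^ A r c = _
  split_ifs with h
  · refine Finset.prod_eq_one fun r _ => Finset.prod_eq_one fun c _ => ?_
    by_cases hA : A r c = 0
    · rw [hA, pow_zero]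
    · rw [if_pos (h r c hA), one_pow]
  · push Not at h
    obtain ⟨r, c, hA, hne⟩ := h
    refine Finset.prod_eq_zero (Finset.mem_univ r) (Finset.prod_eq_zero (Finset.mem_univ c) ?_)
    rw [if_neg hne, zero_pow hA]

theorem card_orderEmbedding_fin (k n : ℕ) : Fintype.card (Fin k ↪o Fin n) = n.choose k := by
  rw [← Nat.card_eq_fintype_card, Nat.card_congr Set.powersetCard.ofFinEmbEquiv,
    Set.powersetCard.card, Nat.card_fin]

open scoped Classical in
-- A placement has weight 1 when `f r = g c` at every nonzero coefficient, and 0 otherwise. With no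
-- zero row or column, weight 1 forces `f` and `g` to have the same range, hence to be equal, and
-- `M` to be diagonal. For a diagonal `M`, whose diagonal coefficients are nonzero, the surviving
-- pairs are the `f = g`, counted by a binomial coefficient.
theorem evalAt_identity (n : ℕ) (M : PackedMatrix) :
    evalAt (OrderedMatrix.identity R n) M.mat =
      if M.IsDiagonal then (n.choose M.row : R) else 0 := by
  obtain ⟨k, l, A, hA, hA'⟩ := M
  change ∑ f : Fin k ↪o Fin n, ∑ g : Fin l ↪o Fin n,
    weight A (OrderedMatrix.identity R n).entry f g = _
  simp_rw [weight_identity]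
  split_ifs with h
  · obtain ⟨hkl, h⟩ := h
    dsimp only at hkl h
    subst hkl
    have hd : ∀ i, A i i ≠ 0 := by
      intro i
      obtain ⟨j, hj⟩ := hA i
      by_cases hij : i = j
      · rwa [← hij] at hj
      · exact absurd (h i j (fun h => hij (Fin.ext h))) hj
    have key : ∀ f g : Fin k ↪o Fin n, (∀ r c, A r c ≠ 0 → f r = g c) ↔ f = g := by
      refine fun f g => ⟨fun hfg => ?_, ?_⟩
      · ext i
        rw [hfg i i (hd i)]
      · rintro rfl r c hrc
        by_contra hne
        exact hrc (h r c fun h => hne (congrArg f (Fin.ext h)))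
    simp [key, card_orderEmbedding_fin]
  · refine Finset.sum_eq_zero fun f _ => Finset.sum_eq_zero fun g _ => if_neg fun hfg => h ?_
    have hr : Set.range f = Set.range g := by
      ext x
      constructor
      · rintro ⟨r, rfl⟩
        obtain ⟨c, hc⟩ := hA r
        exact ⟨c, (hfg r c hc).symm⟩
      · rintro ⟨c, rfl⟩
        obtain ⟨r, hr⟩ := hA' c
        exact ⟨r, hfg r c hr⟩
    have hkl : k = l := by
      have h1 := Set.ncard_range_of_injective f.injective
      have h2 := Set.ncard_range_of_injective g.injective
      rw [hr, h2] at h1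
      simpa using h1.symm
    subst hkl
    obtain rfl : f = g := OrderEmbedding.range_inj.1 hr
    refine ⟨rfl, fun i j hij => ?_⟩
    by_contra h0
    exact hij (congrArg Fin.val (f.injective (hfg i j h0)))

/-! ### Evaluation at generic matrices -/

/-- The matrix of size `k × l` with indeterminate coefficients. -/
noncomputable def genericMatrix (K : Type*) [Field K] (k l : ℕ) :
    OrderedMatrix (MvPolynomial (Fin k × Fin l) K) where
  Row := Fin k
  Col := Fin l
  entry i j := MvPolynomial.X (i, j)

theorem mu_id (k : ℕ) : mu (id : Fin k → Fin k) = 1 := by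
  ext i j
  simp [mu, Matrix.one_apply]

theorem coe_orderEmbedding_fin {k : ℕ} (f : Fin k ↪o Fin k) : ⇑f = id := by
  have h : f = RelEmbedding.refl _ := by
    refine OrderEmbedding.range_inj.1 ?_
    rw [(Finite.injective_iff_surjective.1 f.injective).range_eq]
    exact (Set.range_id).symm
  rw [h]
  rfl

/-- The only strictly increasing map from `Fin k` to itself is the identity. -/
abbrev uniqueOrderEmbeddingFin (k : ℕ) : Unique (Fin k ↪o Fin k) where
  default := RelEmbedding.refl _
  uniq f := DFunLike.coe_injective <|
    (coe_orderEmbedding_fin f).trans (coe_orderEmbedding_fin _).symm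

variable (K : Type*) [Field K]

theorem weight_genericMatrix {k l n m : ℕ} (A : Matrix (Fin k) (Fin l) ℕ) (f : Fin k → Fin n)
    (g : Fin l → Fin m) :
    weight A (genericMatrix K n m).entry f g = MvPolynomial.monomial
      (Finsupp.equivFunOnFinite.symm fun p => (mu f * A * (mu g)ᵀ) p.1 p.2) 1 := by
  refine (weight_mu A f g (genericMatrix K n m).entry id id).symm.trans ?_
  rw [MvPolynomial.monomial_eq, MvPolynomial.C_1, one_mul,
    Finsupp.prod_fintype _ _ (fun _ => pow_zero _), Fintype.prod_prod_type]
  rfl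

/-- A row or column of `N` missed by `f` or `g` would be zero. So both maps are onto, and a strictly
increasing bijection of `Fin k` is the identity. -/
theorem eq_of_mu_mul_mu_eq {M N : PackedMatrix} (f : Fin M.row ↪o Fin N.row)
    (g : Fin M.col ↪o Fin N.col) (h : mu f * M.mat * (mu g)ᵀ = N.mat) : M = N := by
  obtain ⟨k, l, A, hA, hA'⟩ := M
  obtain ⟨n, m, B, hB, hB'⟩ := N
  dsimp only at f g h
  have hex : ∀ i j, B i j ≠ 0 → (∃ r, f r = i) ∧ ∃ c, g c = j := by
    intro i j hij
    rw [← h, mu_mul_mul_apply] at hij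
    obtain ⟨c, -, hc⟩ := Finset.exists_ne_zero_of_sum_ne_zero hij
    obtain ⟨r, -, hr⟩ := Finset.exists_ne_zero_of_sum_ne_zero hc
    obtain ⟨h1, h2⟩ := (ite_ne_right_iff.1 hr).1
    exact ⟨⟨r, h1.symm⟩, c, h2.symm⟩
  have hf : Function.Surjective f := fun i => (hB i).elim fun j hj => (hex i j hj).1
  have hg : Function.Surjective g := fun j => (hB' j).elim fun i hi => (hex i j hi).2
  obtain rfl : k = n := by
    simpa using Fintype.card_congr (Equiv.ofBijective f ⟨f.injective, hf⟩)
  obtain rfl : l = m := by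
    simpa using Fintype.card_congr (Equiv.ofBijective g ⟨g.injective, hg⟩)
  rw [coe_orderEmbedding_fin f, coe_orderEmbedding_fin g, mu_id, mu_id, Matrix.transpose_one, Matrix.mul_one, Matrix.one_mul] at h
  subst h
  rfl

open scoped Classical in
-- Each placement contributes one monic monomial, whose exponents are `M` padded by zero rows and
-- columns; being packed, `N` is obtained only from itself, and only once.
theorem coeff_evalAt_genericMatrix (M N : PackedMatrix) :
    (evalAt (genericMatrix K N.row N.col) M.mat).coeff
      (Finsupp.equivFunOnFinite.symm fun p => N.mat p.1 p.2) = if M = N then 1 else 0 := by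
  change (∑ f : Fin M.row ↪o Fin N.row, ∑ g : Fin M.col ↪o Fin N.col,
    weight M.mat (genericMatrix K N.row N.col).entry f g).coeff _ = _
  simp_rw [weight_genericMatrix, MvPolynomial.coeff_sum, MvPolynomial.coeff_monomial,
    EmbeddingLike.apply_eq_iff_eq]
  have hiff : ∀ B : Matrix (Fin N.row) (Fin N.col) ℕ,
      ((fun p : Fin N.row × Fin N.col => B p.1 p.2) = fun p => N.mat p.1 p.2) ↔ B = N.mat :=
    fun B => ⟨fun h => by ext i j; exact congrFun h (i, j), fun h => by rw [h]⟩
  simp_rw [hiff]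
  split_ifs with h
  · subst h
    have := uniqueOrderEmbeddingFin M.row
    have := uniqueOrderEmbeddingFin M.col
    rw [Fintype.sum_unique, Fintype.sum_unique, coe_orderEmbedding_fin, coe_orderEmbedding_fin,
      mu_id, mu_id, Matrix.transpose_one, Matrix.mul_one, Matrix.one_mul, if_pos rfl]
  · exact Finset.sum_eq_zero fun f _ => Finset.sum_eq_zero fun g _ =>
      if_neg fun hfg => h (eq_of_mu_mul_mu_eq f g hfg)

end PackedMatrix

/-! ## The double bialgebra of packed matrices -/

namespace HPack

open PackedMatrix

variable (K : Type*) [Field K]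

section Character

variable {R : Type*} [CommRing R] [Algebra K R]

/-- The character of `HPack K` given by the evaluation at a matrix. -/
noncomputable def character (a : OrderedMatrix R) : HPack K →ₗ[K] R :=
  Finsupp.lift R K PackedMatrix fun M => evalAt a M.mat

@[simp]
theorem character_basis (a : OrderedMatrix R) (M : PackedMatrix) :
    character K a (basis K M) = evalAt a M.mat := by
  simp [character, basis]

/-- The laws for sums and products of matrices hold only up to isomorphism, which suffices because
the axioms are tested through characters. -/
theorem character_eq_of_iso {a b : OrderedMatrix R} (h : a.Iso b) :
    character K a = character K b := by
  rw [character, character]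
  simp_rw [evalAt_eq_of_iso h]

variable {K} in
theorem hom_ext {V : Type*} [AddCommMonoid V] [Module K V] {f g : HPack K →ₗ[K] V}
    (h : ∀ M, f (basis K M) = g (basis K M)) : f = g :=
  Finsupp.lhom_ext' fun M => LinearMap.ext_ring (h M)

@[simp]
theorem ops_mul_basis (M N : PackedMatrix) :
    (ops K).mul (basis K M ⊗ₜ basis K N) = quasiShuffle K M N := by
  simp [ops, basis]

@[simp]
theorem ops_comul_basis (M : PackedMatrix) :
    (ops K).comul (basis K M) = deconcatenation K M := by
  simp [ops, basis]

@[simp]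
theorem ops_delta_basis (M : PackedMatrix) :
    (ops K).delta (basis K M) = internalCoproduct K M := by
  simp [ops, basis]

theorem character_one (a : OrderedMatrix R) : character K a (ops K).one = 1 := by
  change character K a (basis K PackedMatrix.empty) = 1
  rw [character_basis]
  exact evalAt_zero a _

theorem character_mul (a : OrderedMatrix R) (x y : HPack K) :
    character K a ((ops K).mul (x ⊗ₜ y)) = character K a x * character K a y := by
  -- Both sides are bilinear, so after currying they are compared on pairs of packed matrices.
  have h : (TensorProduct.mk K (HPack K) (HPack K)).compr₂ (character K a ∘ₗ (ops K).mul) =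
      (LinearMap.mul K R).compl₁₂ (character K a) (character K a) := by
    refine hom_ext fun M => hom_ext fun N => ?_
    simp only [LinearMap.compr₂_apply, TensorProduct.mk_apply, LinearMap.comp_apply,
      ops_mul_basis, LinearMap.compl₁₂_apply, LinearMap.mul_apply', character_basis, quasiShuffle,
      map_sum]
    exact sum_evalAt_push_quasiShuffle a M N
  exact LinearMap.congr_fun₂ h x y

end Character

theorem tensorForm_character_comp_comul (a b : OrderedMatrix K) :
    tensorForm (character K a) (character K b) ∘ₗ (ops K).comul =
      character K (a.directSum b) := by
  refine hom_ext fun M => ?_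
  simp only [LinearMap.comp_apply, ops_comul_basis, deconcatenation, map_sum, tensorForm_tmul,
    character_basis, sum_evalAt_block]

theorem tensorForm_character_comp_delta (a b : OrderedMatrix K) :
    tensorForm (character K a) (character K b) ∘ₗ (ops K).delta =
      character K (a.kronecker b) := by
  classical
  refine hom_ext fun M => ?_
  simp only [LinearMap.comp_apply, ops_delta_basis, internalCoproduct, map_sum, tensorForm_tmul,
    character_basis]
  exact sum_evalAt_adm a b M.mat

theorem ops_counit : (ops K).counit = character K (OrderedMatrix.identity K 0) := by
  classical
  refine hom_ext fun M => ?_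
  rw [character_basis, evalAt_identity]
  simp only [ops, basis, Finsupp.lift_apply, zero_smul, Finsupp.sum_single_index, one_smul]
  by_cases h : M = PackedMatrix.empty
  · subst h
    have hd : PackedMatrix.empty.IsDiagonal := ⟨rfl, fun i => i.elim0⟩
    have hr : PackedMatrix.empty.row = 0 := rfl
    simp [hd, hr]
  · have : M.row ≠ 0 := fun h0 => h (eq_empty_of_row_eq_zero h0)
    simp [h, Nat.choose_eq_zero_of_lt (Nat.pos_of_ne_zero this)]

theorem ops_deltaCounit : (ops K).deltaCounit = character K (OrderedMatrix.identity K 1) := by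
  classical
  refine hom_ext fun M => ?_
  rw [character_basis, evalAt_identity]
  simp only [ops, basis, Finsupp.lift_apply, zero_smul, Finsupp.sum_single_index, one_smul]
  by_cases h : M = PackedMatrix.empty
  · subst h
    have hd : PackedMatrix.empty.IsDiagonal := ⟨rfl, fun i => i.elim0⟩
    have hr : PackedMatrix.empty.row = 0 := rfl
    simp [hd, hr]
  · have h0 : M.row ≠ 0 := fun h0 => h (eq_empty_of_row_eq_zero h0)
    by_cases h1 : M.row = 1
    · by_cases h2 : M.col = 1
      · have hd : M.IsDiagonal := ⟨h1.trans h2.symm, fun i j hij => by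
          have := i.is_lt
          have := j.is_lt
          omega⟩
        simp [h1, h2, hd]
      · have hd : ¬ M.IsDiagonal := fun hd => h2 (hd.1.symm.trans h1)
        simp [h, h2, hd]
    -- A diagonal matrix with at least two rows has no placement in the identity of size 1.
    · simp [h, h1, Nat.choose_eq_zero_of_lt (show 1 < M.row by omega)]

theorem coeff_character_genericMatrix (N : PackedMatrix) (x : HPack K) :
    (character K (genericMatrix K N.row N.col) x).coeff
      (Finsupp.equivFunOnFinite.symm fun p => N.mat p.1 p.2) = x N := by
  classical
  have h : MvPolynomial.lcoeff K (Finsupp.equivFunOnFinite.symm fun p => N.mat p.1 p.2) ∘ₗ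
      character K (genericMatrix K N.row N.col) = Finsupp.lapply N := by
    refine hom_ext fun M => ?_
    rw [LinearMap.comp_apply, character_basis, MvPolynomial.lcoeff_apply,
      coeff_evalAt_genericMatrix]
    simp [basis, Finsupp.single_apply]
  exact LinearMap.congr_fun h x

/-- The evaluation of the indeterminates of a generic matrix. -/
theorem aeval_character_genericMatrix {k l : ℕ} (u : Fin k × Fin l → K) (x : HPack K) :
    MvPolynomial.aeval u (character K (genericMatrix K k l) x) =
      character K ⟨Fin k, Fin l, fun i j => u (i, j)⟩ x := by
  have h : (MvPolynomial.aeval u).toLinearMap ∘ₗ character K (genericMatrix K k l) =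
      character K ⟨Fin k, Fin l, fun i j => u (i, j)⟩ := by
    refine hom_ext fun M => ?_
    rw [LinearMap.comp_apply, character_basis, character_basis]
    simp only [evalAt, weight, genericMatrix, AlgHom.toLinearMap_apply, map_sum, map_prod, map_pow,
      MvPolynomial.aeval_X]
    rfl
  exact LinearMap.congr_fun h x

/-- If every character kills `x`, its value at each generic matrix is a polynomial vanishing at all
points, hence zero; its coefficients include the coordinates of `x`. -/
theorem separating_character [Infinite K] :
    Separating (character K : OrderedMatrix K → HPack K →ₗ[K] K) := by
  intro x hx
  ext N
  have h : character K (genericMatrix K N.row N.col) x = 0 := by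
    refine MvPolynomial.funext fun u => ?_
    rw [map_zero, ← MvPolynomial.coe_aeval_eq_eval, RingHom.coe_coe,
      aeval_character_genericMatrix, hx]
  rw [← coeff_character_genericMatrix, h, MvPolynomial.coeff_zero, Finsupp.zero_apply]

theorem isDoubleBialgebra_ops [Infinite K] : IsDoubleBialgebra (ops K) :=
  .of_separating (separating_character K) (character_one K) (character_mul K)
    OrderedMatrix.directSum OrderedMatrix.kronecker (OrderedMatrix.identity K 0)
    (OrderedMatrix.identity K 1) (tensorForm_character_comp_comul K)
    (tensorForm_character_comp_delta K) (ops_counit K) (ops_deltaCounit K)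
    (fun a b c => character_eq_of_iso K (a.directSum_assoc b c))
    (fun a => character_eq_of_iso K a.identity_zero_directSum)
    (fun a => character_eq_of_iso K a.directSum_identity_zero)
    (fun a b c => character_eq_of_iso K (a.kronecker_assoc b c))
    (fun a => character_eq_of_iso K a.identity_one_kronecker)
    (fun a => character_eq_of_iso K a.kronecker_identity_one)
    (fun a b c => character_eq_of_iso K (a.directSum_kronecker b c))
    (fun a => character_eq_of_iso K a.identity_zero_kronecker)

/-! ## The morphism to polynomials -/

theorem eval_hilbertPoly [CharZero K] (k n : ℕ) :
    (hilbertPoly K k).eval (n : K) = n.choose k := by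
  have h : (k.factorial : K) ≠ 0 := Nat.cast_ne_zero.2 k.factorial_ne_zero
  rw [hilbertPoly, Polynomial.eval_mul, Polynomial.eval_C, Polynomial.eval_prod]
  simp only [Polynomial.eval_sub, Polynomial.eval_X, Polynomial.eval_C]
  rw [← descPochhammer_eval_eq_prod_range, descPochhammer_eval_eq_descFactorial,
    Nat.descFactorial_eq_factorial_mul_choose, Nat.cast_mul, inv_mul_cancel_left₀ h]

open scoped Classical in
/-- The linear map sending a diagonal packed matrix to a Hilbert polynomial, and the other packed
matrices to `0`. -/
noncomputable def toPoly : HPack K →ₗ[K] K[X] :=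
  Finsupp.lift K[X] K PackedMatrix fun M => if M.IsDiagonal then hilbertPoly K M.row else 0

open scoped Classical in
theorem toPoly_basis (M : PackedMatrix) :
    toPoly K (basis K M) = if M.IsDiagonal then hilbertPoly K M.row else 0 := by
  simp [toPoly, basis]

variable [CharZero K]

theorem evalNat_comp_toPoly (n : ℕ) :
    evalNat K n ∘ₗ toPoly K = character K (OrderedMatrix.identity K n) := by
  classical
  refine hom_ext fun M => ?_
  rw [LinearMap.comp_apply, toPoly_basis, character_basis, evalAt_identity, evalNat_apply]
  split_ifs
  · exact eval_hilbertPoly K _ _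
  · simp

/-- Tested at natural numbers, compatibility with the coproducts says that sums and Kronecker
products of identity matrices are identity matrices of sizes `n + m` and `n * m`. -/
theorem isDoubleBialgebraHom_toPoly : IsDoubleBialgebraHom (ops K) (polyOps K) (toPoly K) := by
  have h : ∀ n x, evalNat K n (toPoly K x) = character K (OrderedMatrix.identity K n) x :=
    fun n => LinearMap.congr_fun (evalNat_comp_toPoly K n)
  have hsep := separating_evalNat K
  refine ⟨hsep.eq fun n => ?_, fun a b => hsep.eq fun n => ?_,
    fun a => (hsep.tensor hsep).eq fun p => ?_, fun a => ?_,
    fun a => (hsep.tensor hsep).eq fun p => ?_, fun a => ?_⟩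
  · rw [h, character_one]
    simp [polyOps, evalNat]
  · rw [h, character_mul, ← h, ← h]
    simp [polyOps, evalNat]
  · rw [← LinearMap.comp_apply, tensorForm_evalNat_comp_comul, tensorForm_map,
      evalNat_comp_toPoly, evalNat_comp_toPoly, h,
      ← LinearMap.comp_apply (tensorForm _ _), tensorForm_character_comp_comul,
      character_eq_of_iso K (OrderedMatrix.identity_directSum_identity p.1 p.2)]
  · rw [polyOps_counit, ops_counit, h]
  · rw [← LinearMap.comp_apply, tensorForm_evalNat_comp_delta, tensorForm_map,
      evalNat_comp_toPoly, evalNat_comp_toPoly, h,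
      ← LinearMap.comp_apply (tensorForm _ _), tensorForm_character_comp_delta,
      character_eq_of_iso K (OrderedMatrix.identity_kronecker_identity p.1 p.2)]
  · rw [polyOps_deltaCounit, ops_deltaCounit, h]

variable {K} in
theorem eq_toPoly {ψ : HPack K →ₗ[K] K[X]} (hψ : IsDoubleBialgebraHom (ops K) (polyOps K) ψ) :
    ψ = toPoly K := by
  have h1 : evalNat K 1 ∘ₗ ψ = character K (OrderedMatrix.identity K 1) := by
    rw [← polyOps_deltaCounit, ← ops_deltaCounit]
    exact LinearMap.ext hψ.map_deltaCounit
  have h : ∀ n, evalNat K n ∘ₗ ψ = character K (OrderedMatrix.identity K n) := by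
    intro n
    induction n with
    | zero =>
      rw [← polyOps_counit, ← ops_counit]
      exact LinearMap.ext hψ.map_counit
    | succ n ih =>
      -- Evaluation at `n + 1` is the convolution along `Δ` of the evaluations at `n` and 1, and
      -- likewise for the identity matrices.
      refine LinearMap.ext fun x => ?_
      rw [← tensorForm_evalNat_comp_comul, LinearMap.comp_apply, LinearMap.comp_apply,
        hψ.map_comul, tensorForm_map, ih, h1, ← LinearMap.comp_apply,
        tensorForm_character_comp_comul,
        character_eq_of_iso K (OrderedMatrix.identity_directSum_identity n 1)]
  refine LinearMap.ext fun x => (separating_evalNat K).eq fun n => ?_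
  rw [← LinearMap.comp_apply, ← LinearMap.comp_apply, h, evalNat_comp_toPoly]

end HPack

theorem mainTheorem5 (K : Type*) [Field K] [CharZero K] :
    IsDoubleBialgebra (HPack.ops K) ∧ IsDoubleBialgebra (polyOps K) ∧
      ∃ φ : HPack K →ₗ[K] K[X],
        (IsDoubleBialgebraHom (HPack.ops K) (polyOps K) φ ∧
          ∀ ψ : HPack K →ₗ[K] K[X],
            IsDoubleBialgebraHom (HPack.ops K) (polyOps K) ψ → ψ = φ) ∧
        ∀ M : PackedMatrix,
          (M.IsDiagonal → φ (HPack.basis K M) = hilbertPoly K M.row) ∧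
          (¬ M.IsDiagonal → φ (HPack.basis K M) = 0) := by
  classical
  refine ⟨HPack.isDoubleBialgebra_ops K, isDoubleBialgebra_polyOps K, HPack.toPoly K,
    ⟨HPack.isDoubleBialgebraHom_toPoly K, fun ψ hψ => HPack.eq_toPoly hψ⟩, fun M => ⟨?_, ?_⟩⟩
  · intro h
    rw [HPack.toPoly_basis, if_pos h]
  · intro h
    rw [HPack.toPoly_basis, if_neg h]
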